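/- Let $N\ge 1$, let $a_1,\dots,a_N$ be real constants, $p_N(\lambda)=\sum_{k=1}^N a_k\lambda^{2k+1}(-1)^k$, let $\kappa=\cos$ or $\kappa=\sin$, and put $I(t,x,\lambda)=\kappa\bigl(\lambda x+t\,p_N(\lambda)\bigr)$. Let $a\le b$, $c\le d$, $D=[a,b]\times[c,d]$ and $\varkappa=\max(b-a,d-c)$. For an even function $\varphi$ and a random variable $\zeta$ put $\tau_\varphi(\zeta)=\inf\{r>0:\ \mathsf E e^{\lambda\zeta}\le e^{\varphi(r\lambda)}\ \text{for all }\lambda\in\mathbb R\}$. A real random process $y=\{y(u),u\in\mathbb R\}$ is strictly $\varphi$-sub-Gaussian with determining constant $C_y$ if each $y(u)$ is centered with $\tau_\varphi(y(u))<\infty$ and $\tau_\varphi(\zeta)\le C_y(\mathsf E\zeta^2)^{1/2}$ for every linear combination $\zeta$ of the $y(u)$. Let $y$ be a real second-order process whose covariance function $\Gamma_y(s,t)=\mathsf E\,y(s)y(t)$ has finite Vitali variation on $\mathbb R^2$, and write $\iint f\,d|\Gamma_y|$ for the Stieltjes integral with respect to the variation of $\Gamma_y$ (the limit of the sums $\sum_{i,j}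 f\,|\Delta_i\Delta_j\Gamma_y|$). Let $\rho\in(0,1]$ be such that $$\iint_{\mathbb R^2}|\lambda|^{(2N+1)(\rho+1)}|\mu|^{(2N+1)(\rho+1)}\,d|\Gamma_y(\lambda,\mu)|<\infty ,$$ and define $C_Z\in[0,\infty]$ by $$C_Z^2=\iint_{\mathbb R^2}\Bigl(\bigl(\tfrac{|\lambda|}2\bigr)^\rho+\bigl|\tfrac12 p_N(\lambda)\bigr|^\rho\Bigr)\Bigl(\bigl(\tfrac{|\mu|}2\bigr)^\rho+\bigl|\tfrac12 p_N(\mu)\bigr|^\rho\Bigr)\,d|\Gamma_y(\lambda,\mu)| .$$ Let $U(t,x)=\int_{-\infty}^{\infty}I(t,x,\lambda)\,dy(\lambda)$, $(t,x)\in D$, the integral being taken in the mean-square sense. Suppose first that $y$ is strictly $\varphi$-sub-Gaussian with determining constant $C_y$, where $\varphi(x)=|x|^\alpha/\alpha$, $1<\alpha\le 2$. Then: (i) $U(t,x)$ exists for all $(t,x)\in D$ and has a version that is continuous on $D$ with probability one. For every $h>0$ $$\sup_{\substack{t,t_1\in[a,b]:\,|t-t_1|\le h\\ x,x_1\in[c,d]:\,|x-x_1|\le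 h}}\tau_\varphi\bigl(U(t,x)-U(t_1,x_1)\bigr)\le 2C_ZC_y\,h^\rho ,$$ and there is a finite constant $K$ such that the same supremum is at most $Kh^\rho$ for every $h>0$. (ii) Let $U$ be a version that is continuous with probability one, and put $\varepsilon_0=\sup_{(t,x)\in D}\tau_\varphi(U(t,x))$. Then $\varepsilon_0<\infty$, and for every $\theta\in(0,1)$ with $\theta\varepsilon_0<2C_ZC_y(\varkappa/2)^\rho$, for $\gamma$ with $\frac1\alpha+\frac1\gamma=1$, and for every $u>0$, $$\mathsf P\Bigl\{\sup_{(t,x)\in D}|U(t,x)|>u\Bigr\}\le 2\exp\Bigl\{-\frac{u^\gamma(1-\theta)^\gamma}{\gamma\,\varepsilon_0^\gamma}\Bigr\}(2eC_ZC_y)^{2/\rho}\varkappa^2(\theta\varepsilon_0)^{-2/\rho}$$ (if $\varepsilon_0=0$ the left-hand side is $0$). Now suppose instead that $y$ is a centered Gaussian process, and take $\varphi(x)=x^2/2$ in the definition of $\varepsilon_0$. Then $U$ exists and has a version that is continuous on $D$ with probability one; for every such version $\varepsilon_0<\infty$, and for every $\theta\in(0,1)$ with $\theta\varepsilon_0<2C_Z(\varkappa/2)^\rho$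 and every $u>0$, $$\mathsf P\Bigl\{\sup_{(t,x)\in D}|U(t,x)|>u\Bigr\}\le 2\exp\Bigl\{-\frac{u^2(1-\theta)^2}{2\varepsilon_0^2}\Bigr\}(2eC_Z)^{2/\rho}\varkappa^2(\theta\varepsilon_0)^{-2/\rho}.$$ -/

import Mathlib

open MeasureTheory ProbabilityTheory Filter Topology Set
open scoped ENNReal NNReal

noncomputable section

/-! ### `φ`-sub-Gaussian random variables and processes -/

/-- The Orlicz function `φ(x) = |x| ^ α / α`. -/
def powerOrlicz (α : ℝ) (x : ℝ) : ℝ := |x| ^ α / α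

/-- The `φ`-sub-Gaussian standard
`τ_φ(ζ) = inf {a > 0 : E exp(l ζ) ≤ exp(φ(a l)) for all l}`, with values in `[0, ∞]`
(it is `∞` if there is no such `a`). -/
def subGaussianStandard {Ω : Type*} [MeasurableSpace Ω] (φ : ℝ → ℝ) (ζ : Ω → ℝ)
    (P : Measure Ω) : ℝ≥0∞ :=
  ⨅ (a : ℝ) (_ : 0 < a ∧ ∀ l : ℝ,
      ∫⁻ ω, ENNReal.ofReal (Real.exp (l * ζ ω)) ∂P ≤ ENNReal.ofReal (Real.exp (φ (a * l)))),
    ENNReal.ofReal a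

/-- `ζ` belongs to the space `Sub_φ(Ω)` of `φ`-sub-Gaussian random variables. -/
structure IsPhiSubGaussian {Ω : Type*} [MeasurableSpace Ω] (φ : ℝ → ℝ) (ζ : Ω → ℝ)
    (P : Measure Ω) : Prop where
  aemeasurable : AEMeasurable ζ P
  centered : ∫ ω, ζ ω ∂P = 0
  exp_bound : ∃ a : ℝ, 0 < a ∧ ∀ l : ℝ,
    ∫⁻ ω, ENNReal.ofReal (Real.exp (l * ζ ω)) ∂P ≤ ENNReal.ofReal (Real.exp (φ (l * a)))

/-- `y` is a strictly `φ`-sub-Gaussian process with determining constant `C`: its values are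
`φ`-sub-Gaussian and `τ_φ(∑ cᵢ y(uᵢ)) ≤ C (E (∑ cᵢ y(uᵢ))²)^{1/2}` for all (finite) linear
combinations.  -/
structure IsStrictlyPhiSubGaussian {Ω : Type*} [MeasurableSpace Ω] (φ : ℝ → ℝ)
    (y : ℝ → Ω → ℝ) (C : ℝ≥0) (P : Measure Ω) : Prop where
  subGaussian : ∀ u, IsPhiSubGaussian φ (y u) P
  standard_le : ∀ (s : Finset ℝ) (c : ℝ → ℝ),
    subGaussianStandard φ (fun ω => ∑ u ∈ s, c u * y u ω) P
      ≤ (C : ℝ≥0∞) * eLpNorm (fun ω => ∑ u ∈ s, c u * y u ω) 2 P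

/-! ### Covariance functions of finite Vitali variation -/

/-- `Γ_y(s, t) = E y(s) y(t)`. -/
def covFun {Ω : Type*} [MeasurableSpace Ω] (y : ℝ → Ω → ℝ) (P : Measure Ω) (s t : ℝ) : ℝ :=
  ∫ ω, y s ω * y t ω ∂P

/-- The increment of `Γ` over the rectangle `[s, s'] × [t, t']`. -/
def rectIncrement (Γ : ℝ → ℝ → ℝ) (s s' t t' : ℝ) : ℝ :=
  Γ s' t' - Γ s' t - Γ s t' + Γ s t

/-- `Γ` has finite (Vitali) variation on the plane: the sums `∑ᵢ ∑ⱼ |Δᵢ Δⱼ Γ|` over all finite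
grids `s₀ ≤ ⋯ ≤ sₙ`, `t₀ ≤ ⋯ ≤ tₘ` are bounded. -/
def HasFiniteVitaliVariation (Γ : ℝ → ℝ → ℝ) : Prop :=
  ∃ V : ℝ, ∀ (n m : ℕ) (s t : ℕ → ℝ), Monotone s → Monotone t →
    ∑ i ∈ Finset.range n, ∑ j ∈ Finset.range m,
      |rectIncrement Γ (s i) (s (i + 1)) (t j) (t (j + 1))| ≤ V

/-- The integral `∫∫ f(l, m) d|Γ(l, m)|` over the plane of a continuous function `f ≥ 0` with
respect to the variation of `Γ`, with values in `[0, ∞]`: the limit of the sums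
`∑ᵢ ∑ⱼ f |Δᵢ Δⱼ Γ|` as the grid is refined and exhausts the plane. With the infimum of `f` over
each cell as the value of `f`, the sums increase under refinement and extension of the grid, and
the limit is their supremum. -/
def variationIntegral (Γ : ℝ → ℝ → ℝ) (f : ℝ → ℝ → ℝ≥0∞) : ℝ≥0∞ :=
  ⨆ (n : ℕ) (m : ℕ) (s : ℕ → ℝ) (t : ℕ → ℝ) (_ : Monotone s) (_ : Monotone t),
    ∑ i ∈ Finset.range n, ∑ j ∈ Finset.range m,
      (⨅ (u ∈ Icc (s i) (s (i + 1))) (v ∈ Icc (t j) (t (j + 1))), f u v) *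
        ENNReal.ofReal |rectIncrement Γ (s i) (s (i + 1)) (t j) (t (j + 1))|

/-! ### Mean-square Stieltjes integrals -/

/-- `J = ∫_A^B f(l) dy(l)` as the mean-square limit of the Riemann-Stieltjes sums
`∑ᵢ f(ξᵢ) (y(sᵢ₊₁) - y(sᵢ))`, `ξᵢ ∈ [sᵢ, sᵢ₊₁]`, as the mesh of the partition tends to `0`. -/
def IsMeanSquareIntegralOn {Ω : Type*} [MeasurableSpace Ω] (f : ℝ → ℝ) (y : ℝ → Ω → ℝ)
    (A B : ℝ) (J : Ω → ℝ) (P : Measure Ω) : Prop :=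
  MemLp J 2 P ∧
  ∀ ε : ℝ≥0∞, 0 < ε → ∃ δ : ℝ, 0 < δ ∧ ∀ (n : ℕ) (s ξ : ℕ → ℝ), Monotone s →
    s 0 = A → s n = B → (∀ i < n, s (i + 1) - s i < δ) →
    (∀ i < n, ξ i ∈ Icc (s i) (s (i + 1))) →
    eLpNorm (fun ω => (∑ i ∈ Finset.range n, f (ξ i) * (y (s (i + 1)) ω - y (s i) ω)) - J ω) 2 P
      ≤ ε

/-- `J = ∫_{-∞}^{∞} f(l) dy(l)` in the mean-square sense: the mean-square limit of
`∫_A^B f(l) dy(l)` as `A → -∞`, `B → ∞`. -/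
def IsMeanSquareIntegral {Ω : Type*} [MeasurableSpace Ω] (f : ℝ → ℝ) (y : ℝ → Ω → ℝ)
    (J : Ω → ℝ) (P : Measure Ω) : Prop :=
  MemLp J 2 P ∧
  ∃ K : ℝ → ℝ → Ω → ℝ, (∀ A B : ℝ, A ≤ B → IsMeanSquareIntegralOn f y A B (K A B) P) ∧
    Tendsto (fun p : ℝ × ℝ => eLpNorm (fun ω => K p.1 p.2 ω - J ω) 2 P)
      (atBot ×ˢ atTop) (𝓝 0)

/-! ### The random field `U` -/

/-- The polynomial `∑_{k=1}^N a_k l^{2k+1} (-1)^k`. -/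
def dispersionPoly (N : ℕ) (coef : ℕ → ℝ) (l : ℝ) : ℝ :=
  ∑ k ∈ Finset.Icc 1 N, coef k * l ^ (2 * k + 1) * (-1) ^ k

/-- The kernel `I(t, x, l) = κ(l x + t ∑_{k=1}^N a_k l^{2k+1} (-1)^k)`. -/
def solutionKernel (κ : ℝ → ℝ) (N : ℕ) (coef : ℕ → ℝ) (t x l : ℝ) : ℝ :=
  κ (l * x + t * dispersionPoly N coef l)

/-- The random field `U` on `D` (first coordinate `t`, second coordinate `x`) is given by
`U(t, x) = ∫ I(t, x, l) dy(l)`. -/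
def IsSolutionField {Ω : Type*} [MeasurableSpace Ω] (κ : ℝ → ℝ) (N : ℕ) (coef : ℕ → ℝ)
    (y : ℝ → Ω → ℝ) (D : Set (ℝ × ℝ)) (U : ℝ × ℝ → Ω → ℝ) (P : Measure Ω) : Prop :=
  ∀ p ∈ D, IsMeanSquareIntegral (solutionKernel κ N coef p.1 p.2) y (U p) P

/-- `U` has continuous sample paths on `D` with probability one. -/
def HasContinuousPathsOn {Ω : Type*} [MeasurableSpace Ω] (D : Set (ℝ × ℝ))
    (U : ℝ × ℝ → Ω → ℝ) (P : Measure Ω) : Prop :=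
  ∀ᵐ ω ∂P, ContinuousOn (fun p => U p ω) D

/-- The function `(|l| / 2)^ρ + |½ ∑_{k=1}^N a_k l^{2k+1} (-1)^k|^ρ`. -/
def holderWeight (N : ℕ) (coef : ℕ → ℝ) (ρ l : ℝ) : ℝ :=
  (|l| / 2) ^ ρ + |1 / 2 * dispersionPoly N coef l| ^ ρ

/-- The constant `C_Z ∈ [0, ∞]` for `Z(u) = u ^ ρ`. -/
def constCZ (Γ : ℝ → ℝ → ℝ) (N : ℕ) (coef : ℕ → ℝ) (ρ : ℝ) : ℝ≥0∞ :=
  (variationIntegral Γ fun l m =>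
    ENNReal.ofReal (holderWeight N coef ρ l * holderWeight N coef ρ m)) ^ (1 / 2 : ℝ)

/-- `ε₀ = sup_{(t, x) ∈ D} τ_φ(U(t, x))`. -/
def supStandard {Ω : Type*} [MeasurableSpace Ω] (φ : ℝ → ℝ) (D : Set (ℝ × ℝ))
    (U : ℝ × ℝ → Ω → ℝ) (P : Measure Ω) : ℝ≥0∞ :=
  ⨆ p ∈ D, subGaussianStandard φ (U p) P

end

/-! Regard `y` as a curve `Y` in the Hilbert space `L²(P)`. The squared norm of `∑ cᵢ (Y(sᵢ₊₁) -
Y(sᵢ))` is a quadratic form in the rectangle increments of the covariance `Γ`, hence at most `∑∑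
|cᵢ| |cⱼ| |ΔᵢΔⱼΓ|`. So finite variation makes the Riemann-Stieltjes sums of a continuous integrand
Cauchy (`norm_stieltjesSum_sub_le`), the moment hypothesis controls the tails of the integral over
the line (`exists_isStieltjesIntegral`), and an integrand bounded by `c g` has an integral of norm
at most `c (∬ g ⊗ g d|Γ|)^{1/2}` (`IsStieltjesIntegral.norm_le`).

Every such integral lies in the closed linear span of the values of `y`. Strict sub-Gaussianity
passes to that closure by Fatou's lemma (`IsStrictlyPhiSubGaussian.expMomentLE_of_mem_closure`), so
`τ_φ` of an integral is at most `C_y` times its `L²` norm. Statements about `U` thus reduce to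
pointwise bounds on the kernel: the bound by `1` gives `ε₀ < ∞`, and `|sin z| ≤ |z|^ρ` gives the
Hölder bound with `C_Z` (`abs_solutionKernel_sub_le`). A Hölder constant that is always finite comes
from splitting the integrand at `|λ| = 1` and using the total variation inside, the moment
hypothesis outside (`exists_expMomentLE_sub`).

The Hölder bound gives exponential tails for increments. Continuous averages of the field over nets
of mesh `2^{-k}` then converge uniformly by Borel-Cantelli, and their limit is the continuous
version (`exists_continuous_modification`). For the supremum, points are chained through nets with
meshes chosen so that the `k`-th link has standard at most `θ^k ε₀`. Giving that link the weight `(1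
- θ) θ^k` makes its exponential moment the same at every level. The weighted logarithms of the net
sizes add up to the power factor of the bound, and optimising the exponential parameter yields the
conjugate exponent `γ` (`measure_sup_gt_le`). The Gaussian case is `α = 2`, `C_y = 1`. -/

/-! ### Riemann-Stieltjes integrals along a curve in a Hilbert space -/

section HilbertIntegral

variable {H : Type*} [NormedAddCommGroup H] [InnerProductSpace ℝ H]

/-- The kernel `⟪Y s, Y t⟫` of a curve in a Hilbert space. -/
noncomputable def gramKernel (Y : ℝ → H) (s t : ℝ) : ℝ := inner ℝ (Y s) (Y t)

/-- The Riemann-Stieltjes sum of `f` with respect to `Y`. -/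
noncomputable def stieltjesSum (f : ℝ → ℝ) (Y : ℝ → H) (n : ℕ) (s ξ : ℕ → ℝ) : H :=
  ∑ i ∈ Finset.range n, f (ξ i) • (Y (s (i + 1)) - Y (s i))

/-- The sums `∑ᵢ ∑ⱼ |Δᵢ Δⱼ Γ|` over square grids are at most `V`. -/
def GridVariationLE (Γ : ℝ → ℝ → ℝ) (V : ℝ) : Prop :=
  ∀ (n : ℕ) (s : ℕ → ℝ), (∀ i < n, s i ≤ s (i + 1)) →
    ∑ i ∈ Finset.range n, ∑ j ∈ Finset.range n,
      |rectIncrement Γ (s i) (s (i + 1)) (s j) (s (j + 1))| ≤ V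

lemma monotone_comp_min {n : ℕ} {s : ℕ → ℝ} (hs : ∀ i < n, s i ≤ s (i + 1)) :
    Monotone fun i => s (min i n) := by
  refine monotone_nat_of_le_succ fun i => ?_
  rcases lt_or_ge i n with h | h
  · have h1 : min i n = i := by omega
    have h2 : min (i + 1) n = i + 1 := by omega
    simp only [h1, h2]; exact hs i h
  · have h1 : min i n = n := by omega
    have h2 : min (i + 1) n = n := by omega
    simp only [h1, h2, le_refl]

lemma le_of_le_succ_of_lt {n : ℕ} {s : ℕ → ℝ} (hs : ∀ i < n, s i ≤ s (i + 1)) {i j : ℕ}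
    (hij : i ≤ j) (hj : j ≤ n) : s i ≤ s j := by
  have := monotone_comp_min hs hij
  simpa [min_eq_left hj, min_eq_left (hij.trans hj)] using this

/-- A grid ordered only up to index `n` becomes monotone on `ℕ` when frozen after `n`; the cells in
the sum do not change. The weaker ordering condition suits the common refinement used below, which
is controlled only up to its last point. -/
lemma HasFiniteVitaliVariation.exists_gridVariationLE {Γ : ℝ → ℝ → ℝ}
    (h : HasFiniteVitaliVariation Γ) : ∃ V, 0 ≤ V ∧ GridVariationLE Γ V := by
  obtain ⟨V, hV⟩ := h
  refine ⟨V, by simpa using hV 0 0 (fun _ => 0) (fun _ => 0) monotone_const monotone_const, ?_⟩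
  intro n s hs
  have := hV n n _ _ (monotone_comp_min hs) (monotone_comp_min hs)
  refine le_trans (le_of_eq ?_) this
  refine Finset.sum_congr rfl fun i hi => Finset.sum_congr rfl fun j hj => ?_
  rw [Finset.mem_range] at hi hj
  rw [min_eq_left hi.le, min_eq_left hj.le, min_eq_left (Nat.succ_le_of_lt hi),
    min_eq_left (Nat.succ_le_of_lt hj)]

lemma inner_sub_sub_eq_rectIncrement (Y : ℝ → H) (s s' t t' : ℝ) :
    inner ℝ (Y s' - Y s) (Y t' - Y t) = rectIncrement (gramKernel Y) s s' t t' := by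
  simp only [rectIncrement, gramKernel, inner_sub_left, inner_sub_right]; ring

lemma norm_sq_sum_smul_le (Y : ℝ → H) (n : ℕ) (s c : ℕ → ℝ) :
    ‖∑ i ∈ Finset.range n, c i • (Y (s (i + 1)) - Y (s i))‖ ^ 2 ≤
      ∑ i ∈ Finset.range n, ∑ j ∈ Finset.range n, |c i| * |c j| *
        |rectIncrement (gramKernel Y) (s i) (s (i + 1)) (s j) (s (j + 1))| := by
  rw [← real_inner_self_eq_norm_sq, sum_inner]
  refine Finset.sum_le_sum fun i _ => ?_
  rw [inner_sum]
  refine Finset.sum_le_sum fun j _ => ?_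
  rw [real_inner_smul_left, real_inner_smul_right, inner_sub_sub_eq_rectIncrement, ← mul_assoc]
  refine (le_abs_self _).trans ?_
  rw [abs_mul, abs_mul]

lemma norm_sum_smul_le_of_le {Y : ℝ → H} {V : ℝ} (hV : GridVariationLE (gramKernel Y) V)
    {n : ℕ} {s c : ℕ → ℝ} (hs : ∀ i < n, s i ≤ s (i + 1)) {M : ℝ} (hM : 0 ≤ M)
    (hc : ∀ i < n, |c i| ≤ M) :
    ‖∑ i ∈ Finset.range n, c i • (Y (s (i + 1)) - Y (s i))‖ ≤ M * √V := by
  have h1 : ‖∑ i ∈ Finset.range n, c i • (Y (s (i + 1)) - Y (s i))‖ ^ 2 ≤ M ^ 2 * V := by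
    refine (norm_sq_sum_smul_le Y n s c).trans ?_
    refine le_trans ?_ (mul_le_mul_of_nonneg_left (hV n s hs) (sq_nonneg M))
    rw [Finset.mul_sum]
    refine Finset.sum_le_sum fun i hi => ?_
    rw [Finset.mul_sum]
    refine Finset.sum_le_sum fun j hj => ?_
    rw [Finset.mem_range] at hi hj
    rw [sq]
    exact mul_le_mul_of_nonneg_right
      (mul_le_mul (hc i hi) (hc j hj) (abs_nonneg _) hM) (abs_nonneg _)
  have h2 := Real.sqrt_le_sqrt h1
  rwa [Real.sqrt_sq (norm_nonneg _), Real.sqrt_mul (sq_nonneg M), Real.sqrt_sq hM] at h2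

lemma Finset.sum_range_mul_div_mod {G : Type*} [AddCommMonoid G] (F : ℕ → ℕ → G) (n m : ℕ)
    (hm : 0 < m) : ∑ p ∈ Finset.range (n * m), F (p / m) (p % m) =
      ∑ i ∈ Finset.range n, ∑ j ∈ Finset.range m, F i j := by
  induction n with
  | zero => simp
  | succ n ih =>
    rw [Nat.succ_mul, Finset.sum_range_add, ih, Finset.sum_range_succ]
    congr 1
    refine Finset.sum_congr rfl fun j hj => ?_
    rw [Finset.mem_range] at hj
    have h1 : (n * m + j) / m = n := by
      rw [mul_comm, Nat.mul_add_div hm, Nat.div_eq_of_lt hj, add_zero]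
    have h2 : (n * m + j) % m = j := by
      rw [mul_comm, Nat.mul_add_mod, Nat.mod_eq_of_lt hj]
    rw [h1, h2]

/-- The point `x` moved into `[p, q]`. -/
noncomputable def clampTo (p q x : ℝ) : ℝ := max p (min x q)

lemma clampTo_of_le_left {p q x : ℝ} (h : x ≤ p) : clampTo p q x = p :=
  max_eq_left ((min_le_left _ _).trans h)

lemma clampTo_of_right_le {p q x : ℝ} (hpq : p ≤ q) (h : q ≤ x) : clampTo p q x = q := by
  rw [clampTo, min_eq_right h, max_eq_right hpq]

lemma clampTo_mono {p q x x' : ℝ} (h : x ≤ x') : clampTo p q x ≤ clampTo p q x' :=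
  max_le_max le_rfl (min_le_min h le_rfl)

/-- Both sides are the increment of `Y` over the intersection of `[p, p']` and `[q, q']`, and both
vanish when the interiors are disjoint. This symmetry lets one double sum refine either of two
partitions. -/
lemma clampTo_increment_comm {G : Type*} [AddCommGroup G] (Y : ℝ → G) {p p' q q' : ℝ}
    (hp : p ≤ p') (hq : q ≤ q') :
    Y (clampTo p p' q') - Y (clampTo p p' q) = Y (clampTo q q' p') - Y (clampTo q q' p) := by
  rcases le_total p' q with h | h
  · rw [clampTo_of_right_le hp h, clampTo_of_right_le hp (h.trans hq), clampTo_of_le_left h,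
      clampTo_of_le_left (hp.trans h), sub_self, sub_self]
  rcases le_total q' p with h' | h'
  · rw [clampTo_of_le_left h', clampTo_of_le_left (hq.trans h'), clampTo_of_right_le hq h',
      clampTo_of_right_le hq (h'.trans hp), sub_self, sub_self]
  · have h1 : clampTo p p' q' = clampTo q q' p' := by
      simp only [clampTo]
      rw [max_eq_right (le_min h' hp), max_eq_right (le_min h hq), min_comm]
    have h2 : clampTo p p' q = clampTo q q' p := by
      simp only [clampTo]
      rw [min_eq_left h, min_eq_left h', max_comm]
    rw [h1, h2]

lemma clampTo_increment_eq_zero {G : Type*} [AddCommGroup G] (Y : ℝ → G) {p p' q q' : ℝ}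
    (hp : p ≤ p') (hq : q ≤ q')
    (h : p' ≤ q ∨ q' ≤ p) : Y (clampTo p p' q') - Y (clampTo p p' q) = 0 := by
  rcases h with h | h
  · rw [clampTo_of_right_le hp h, clampTo_of_right_le hp (h.trans hq), sub_self]
  · rw [clampTo_of_le_left h, clampTo_of_le_left (hq.trans h), sub_self]

lemma sum_clampTo_increment {G : Type*} [AddCommGroup G] (Y : ℝ → G) {A B p q : ℝ} {m : ℕ}
    {r : ℕ → ℝ} (hA : r 0 = A)
    (hB : r m = B) (hp : A ≤ p) (hpq : p ≤ q) (hq : q ≤ B) :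
    ∑ j ∈ Finset.range m, (Y (clampTo p q (r (j + 1))) - Y (clampTo p q (r j))) = Y q - Y p := by
  rw [Finset.sum_range_sub (fun j => Y (clampTo p q (r j))), hA, hB, clampTo_of_le_left hp,
    clampTo_of_right_le hpq hq]

/-- Both sums are rewritten over the common refinement, whose cells are the intersections of a cell
of `s` with a cell of `r`. Their difference has coefficients `f (ξ i) - f (η j)`, and on cells that
overlap the two tags are less than `2 δ` apart. -/
lemma norm_stieltjesSum_sub_le {Y : ℝ → H} {V : ℝ} (hV : GridVariationLE (gramKernel Y) V)
    {f : ℝ → ℝ} {A B δ ω : ℝ} (hω : 0 ≤ ω)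
    (hf : ∀ x ∈ Icc A B, ∀ x' ∈ Icc A B, |x - x'| < 2 * δ → |f x - f x'| ≤ ω)
    {n m : ℕ} {s ξ r η : ℕ → ℝ} (hm : 0 < m)
    (hs : ∀ i < n, s i ≤ s (i + 1)) (hr : ∀ i < m, r i ≤ r (i + 1))
    (hs0 : s 0 = A) (hsn : s n = B) (hr0 : r 0 = A) (hrm : r m = B)
    (hsδ : ∀ i < n, s (i + 1) - s i < δ) (hrδ : ∀ i < m, r (i + 1) - r i < δ)
    (hξ : ∀ i < n, ξ i ∈ Icc (s i) (s (i + 1))) (hη : ∀ i < m, η i ∈ Icc (r i) (r (i + 1))) :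
    ‖stieltjesSum f Y n s ξ - stieltjesSum f Y m r η‖ ≤ ω * √V := by
  have hsA : ∀ i ≤ n, A ≤ s i := fun i hi => hs0 ▸ le_of_le_succ_of_lt hs (Nat.zero_le i) hi
  have hsB : ∀ i ≤ n, s i ≤ B := fun i hi => hsn ▸ le_of_le_succ_of_lt hs hi le_rfl
  have hrA : ∀ i ≤ m, A ≤ r i := fun i hi => hr0 ▸ le_of_le_succ_of_lt hr (Nat.zero_le i) hi
  have hrB : ∀ i ≤ m, r i ≤ B := fun i hi => hrm ▸ le_of_le_succ_of_lt hr hi le_rfl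
  -- The common refinement, listed lexicographically: index `p` encodes the pair `(p / m, p % m)`.
  let u : ℕ → ℝ := fun p => clampTo (s (p / m)) (s (p / m + 1)) (r (p % m))
  -- When the two cells do not overlap the tags may be far apart, but the increment is zero, so the
  -- coefficient may be replaced by `0`.
  let c : ℕ → ℕ → ℝ := fun i j =>
    if s (i + 1) ≤ r j ∨ r (j + 1) ≤ s i then 0 else f (ξ i) - f (η j)
  have hu : ∀ p < n * m, u (p + 1) = clampTo (s (p / m)) (s (p / m + 1)) (r (p % m + 1)) := by
    intro p hp
    have hpn : p / m < n := (Nat.div_lt_iff_lt_mul hm).2 hp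
    have hlt : p % m < m := Nat.mod_lt p hm
    rcases Nat.lt_or_ge (p % m + 1) m with h | h
    · have h1 : (p + 1) / m = p / m := by
        rw [Nat.succ_div_of_not_dvd]
        intro hd
        have := Nat.mod_eq_zero_of_dvd hd
        rw [Nat.add_mod, Nat.mod_eq_of_lt (by omega : 1 < m), Nat.mod_eq_of_lt h] at this
        omega
      have h2 : (p + 1) % m = p % m + 1 := by
        rw [Nat.add_mod, Nat.mod_eq_of_lt (by omega : 1 < m), Nat.mod_eq_of_lt h]
      simp only [u, h1, h2]
    · have h3 : p % m + 1 = m := by omega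
      have hd : m ∣ p + 1 := by
        refine ⟨p / m + 1, ?_⟩
        have := Nat.div_add_mod p m
        rw [Nat.mul_add, mul_one]; omega
      have h1 : (p + 1) / m = p / m + 1 := Nat.succ_div_of_dvd hd
      have h2 : (p + 1) % m = 0 := Nat.mod_eq_zero_of_dvd hd
      -- Passing to the next cell of `s`: its first point, the clamp of `A`, equals the last point
      -- of the current cell, the clamp of `B`. So consecutive blocks join without a gap.
      simp only [u, h1, h2, h3, hr0, hrm]
      rw [clampTo_of_le_left (hsA _ hpn), clampTo_of_right_le (hs _ hpn) (hsB _ hpn)]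
  have hs_sum : stieltjesSum f Y n s ξ = ∑ i ∈ Finset.range n, ∑ j ∈ Finset.range m,
      f (ξ i) • (Y (clampTo (s i) (s (i + 1)) (r (j + 1))) -
        Y (clampTo (s i) (s (i + 1)) (r j))) := by
    refine Finset.sum_congr rfl fun i hi => ?_
    rw [Finset.mem_range] at hi
    rw [← Finset.smul_sum, sum_clampTo_increment Y hr0 hrm (hsA i hi.le) (hs i hi) (hsB _ hi)]
  have hr_sum : stieltjesSum f Y m r η = ∑ i ∈ Finset.range n, ∑ j ∈ Finset.range m,
      f (η j) • (Y (clampTo (s i) (s (i + 1)) (r (j + 1))) -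
        Y (clampTo (s i) (s (i + 1)) (r j))) := by
    rw [Finset.sum_comm]
    refine Finset.sum_congr rfl fun j hj => ?_
    rw [Finset.mem_range] at hj
    rw [← Finset.smul_sum, ← sum_clampTo_increment Y hs0 hsn (hrA j hj.le) (hr j hj) (hrB _ hj)]
    congr 1
    refine Finset.sum_congr rfl fun i hi => ?_
    rw [Finset.mem_range] at hi
    rw [clampTo_increment_comm Y (hs i hi) (hr j hj)]
  have hdiff : stieltjesSum f Y n s ξ - stieltjesSum f Y m r η =
      ∑ p ∈ Finset.range (n * m), c (p / m) (p % m) • (Y (u (p + 1)) - Y (u p)) := by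
    rw [hs_sum, hr_sum, ← Finset.sum_sub_distrib]
    have : ∑ p ∈ Finset.range (n * m), c (p / m) (p % m) • (Y (u (p + 1)) - Y (u p)) =
        ∑ p ∈ Finset.range (n * m), (fun i j => c i j • (Y (clampTo (s i) (s (i + 1)) (r (j + 1)))
          - Y (clampTo (s i) (s (i + 1)) (r j)))) (p / m) (p % m) := by
      refine Finset.sum_congr rfl fun p hp => ?_
      rw [Finset.mem_range] at hp
      rw [hu p hp]
    rw [this, Finset.sum_range_mul_div_mod (fun i j => c i j •
      (Y (clampTo (s i) (s (i + 1)) (r (j + 1))) - Y (clampTo (s i) (s (i + 1)) (r j)))) n m hm]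
    refine Finset.sum_congr rfl fun i hi => ?_
    rw [← Finset.sum_sub_distrib]
    refine Finset.sum_congr rfl fun j hj => ?_
    rw [Finset.mem_range] at hi hj
    rw [← sub_smul]
    by_cases h : s (i + 1) ≤ r j ∨ r (j + 1) ≤ s i
    · rw [clampTo_increment_eq_zero Y (hs i hi) (hr j hj) h, smul_zero, smul_zero]
    · simp only [c, if_neg h]
  rw [hdiff]
  refine norm_sum_smul_le_of_le hV (fun p hp => ?_) hω (fun p hp => ?_)
  · rw [hu p hp]
    exact clampTo_mono (hr _ (Nat.mod_lt p hm))
  · have hpn : p / m < n := (Nat.div_lt_iff_lt_mul hm).2 hp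
    have hlt : p % m < m := Nat.mod_lt p hm
    generalize p / m = i at hpn
    generalize p % m = j at hlt
    by_cases h : s (i + 1) ≤ r j ∨ r (j + 1) ≤ s i
    · simp only [c, if_pos h, abs_zero, hω]
    · simp only [c, if_neg h]
      push Not at h
      have h1 := hξ i hpn
      have h2 := hη j hlt
      refine hf _ ⟨(hsA i hpn.le).trans h1.1, h1.2.trans (hsB _ hpn)⟩ _
        ⟨(hrA j hlt.le).trans h2.1, h2.2.trans (hrB _ hlt)⟩ ?_
      have h3 := hsδ i hpn
      have h4 := hrδ j hlt
      rw [abs_lt]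
      constructor <;> linarith [h1.1, h1.2, h2.1, h2.2]

/-- `J = ∫_A^B f dY` as the limit of Riemann-Stieltjes sums. -/
def IsStieltjesIntegralOn (f : ℝ → ℝ) (Y : ℝ → H) (A B : ℝ) (J : H) : Prop :=
  ∀ ε : ℝ, 0 < ε → ∃ δ : ℝ, 0 < δ ∧ ∀ (n : ℕ) (s ξ : ℕ → ℝ), Monotone s →
    s 0 = A → s n = B → (∀ i < n, s (i + 1) - s i < δ) →
    (∀ i < n, ξ i ∈ Icc (s i) (s (i + 1))) → ‖stieltjesSum f Y n s ξ - J‖ ≤ ε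

/-- The partition of `[A, B]` into `n + 1` equal parts, constant from the `(n+1)`-st point on. -/
noncomputable def uniformGrid (A B : ℝ) (n i : ℕ) : ℝ := A + (B - A) * (min i (n + 1) : ℕ) / (n + 1)

lemma uniformGrid_monotone {A B : ℝ} (hAB : A ≤ B) (n : ℕ) : Monotone (uniformGrid A B n) := by
  intro i j hij
  have h : ((min i (n + 1) : ℕ) : ℝ) ≤ (min j (n + 1) : ℕ) := by
    exact_mod_cast min_le_min hij le_rfl
  have : 0 ≤ B - A := sub_nonneg.2 hAB
  unfold uniformGrid
  gcongr

lemma uniformGrid_zero (A B : ℝ) (n : ℕ) : uniformGrid A B n 0 = A := by simp [uniformGrid]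

lemma uniformGrid_last (A B : ℝ) (n : ℕ) : uniformGrid A B n (n + 1) = B := by
  have : (n : ℝ) + 1 ≠ 0 := by positivity
  simp only [uniformGrid, min_self]
  push_cast
  field_simp
  ring

lemma uniformGrid_succ_sub {A B : ℝ} (n : ℕ) {i : ℕ} (hi : i < n + 1) :
    uniformGrid A B n (i + 1) - uniformGrid A B n i = (B - A) / (n + 1) := by
  simp only [uniformGrid, min_eq_left hi.le, min_eq_left (Nat.succ_le_of_lt hi)]
  push_cast
  ring

lemma eventually_uniformGrid_mesh_lt (A B : ℝ) {δ : ℝ} (hδ : 0 < δ) :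
    ∀ᶠ n : ℕ in atTop, (B - A) / ((n : ℝ) + 1) < δ := by
  have h : Tendsto (fun n : ℕ => (B - A) * (1 / ((n : ℝ) + 1))) atTop (𝓝 ((B - A) * 0)) :=
    tendsto_one_div_add_atTop_nhds_zero_nat.const_mul _
  rw [mul_zero] at h
  filter_upwards [h.eventually (gt_mem_nhds hδ)] with n hn
  rwa [mul_one_div] at hn

lemma IsStieltjesIntegralOn.tendsto_uniformGrid {f : ℝ → ℝ} {Y : ℝ → H} {A B : ℝ} {J : H}
    (h : IsStieltjesIntegralOn f Y A B J) (hAB : A ≤ B) :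
    Tendsto (fun n => stieltjesSum f Y (n + 1) (uniformGrid A B n) (uniformGrid A B n))
      atTop (𝓝 J) := by
  rw [Metric.tendsto_nhds]
  intro ε hε
  obtain ⟨δ, hδ, hJ⟩ := h (ε / 2) (by positivity)
  filter_upwards [eventually_uniformGrid_mesh_lt A B hδ] with n hn
  rw [dist_eq_norm]
  refine lt_of_le_of_lt (hJ (n + 1) _ _ (uniformGrid_monotone hAB n) (uniformGrid_zero A B n)
    (uniformGrid_last A B n) (fun i hi => ?_) fun i _ =>
    ⟨le_rfl, uniformGrid_monotone hAB n (Nat.le_succ i)⟩) (by linarith)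
  rw [uniformGrid_succ_sub n hi]; exact hn

/-- Uniform continuity of `f` on `[A, B]` turns the comparison of two fine sums into a Cauchy
property. The limit along uniform grids serves as the integral, and the same comparison covers
arbitrary fine tagged partitions. -/
lemma exists_isStieltjesIntegralOn [CompleteSpace H] {Y : ℝ → H} {V : ℝ}
    (hV : GridVariationLE (gramKernel Y) V) {f : ℝ → ℝ} (hf : Continuous f) {A B : ℝ}
    (hAB : A ≤ B) : ∃ J, IsStieltjesIntegralOn f Y A B J := by
  have huc : ∀ ε : ℝ, 0 < ε → ∃ δ, 0 < δ ∧ ∃ ω, 0 ≤ ω ∧ ω * √V < ε ∧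
      ∀ x ∈ Icc A B, ∀ x' ∈ Icc A B, |x - x'| < 2 * δ → |f x - f x'| ≤ ω := by
    intro ε hε
    have hω : 0 < ε / (√V + 1) := by positivity
    obtain ⟨δ, hδ, h⟩ := Metric.uniformContinuousOn_iff.1
      (isCompact_Icc.uniformContinuousOn_of_continuous hf.continuousOn) _ hω
    refine ⟨δ / 2, by positivity, ε / (√V + 1), hω.le, ?_, fun x hx x' hx' hxx => ?_⟩
    · rw [div_mul_eq_mul_div, div_lt_iff₀ (by positivity)]
      nlinarith [Real.sqrt_nonneg V]
    · exact (h x hx x' hx' (by rw [Real.dist_eq]; linarith)).le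
  let S : ℕ → H := fun n => stieltjesSum f Y (n + 1) (uniformGrid A B n) (uniformGrid A B n)
  have hcomp : ∀ ε : ℝ, 0 < ε → ∃ δ, 0 < δ ∧ ∀ᶠ k in atTop, ∀ (n : ℕ) (s ξ : ℕ → ℝ), Monotone s →
      s 0 = A → s n = B → (∀ i < n, s (i + 1) - s i < δ) →
      (∀ i < n, ξ i ∈ Icc (s i) (s (i + 1))) → ‖stieltjesSum f Y n s ξ - S k‖ < ε := by
    intro ε hε
    obtain ⟨δ, hδ, ω, hω, hωε, h⟩ := huc ε hε
    refine ⟨δ, hδ, ?_⟩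
    filter_upwards [eventually_uniformGrid_mesh_lt A B hδ] with k hk n s ξ hs h0 hn hsδ hξ
    refine lt_of_le_of_lt (norm_stieltjesSum_sub_le hV hω h (Nat.succ_pos k)
      (fun i _ => hs (Nat.le_succ i)) (fun i _ => uniformGrid_monotone hAB k (Nat.le_succ i))
      h0 hn (uniformGrid_zero A B k) (uniformGrid_last A B k) hsδ (fun i hi => ?_) hξ
      fun i _ => ⟨le_rfl, uniformGrid_monotone hAB k (Nat.le_succ i)⟩) hωε
    rw [uniformGrid_succ_sub k hi]; exact hk
  have hcau : CauchySeq S := by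
    rw [Metric.cauchySeq_iff']
    intro ε hε
    obtain ⟨δ, hδ, h⟩ := hcomp ε hε
    obtain ⟨N, hN⟩ := eventually_atTop.1 (h.and (eventually_uniformGrid_mesh_lt A B hδ))
    refine ⟨N, fun n hn => ?_⟩
    rw [dist_eq_norm]
    refine (hN N le_rfl).1 (n + 1) _ _ (uniformGrid_monotone hAB n) (uniformGrid_zero A B n)
      (uniformGrid_last A B n) (fun i hi => ?_) fun i _ =>
      ⟨le_rfl, uniformGrid_monotone hAB n (Nat.le_succ i)⟩
    rw [uniformGrid_succ_sub n hi]; exact (hN n hn).2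
  obtain ⟨J, hJ⟩ := cauchySeq_tendsto_of_complete hcau
  refine ⟨J, fun ε hε => ?_⟩
  obtain ⟨δ, hδ, h⟩ := hcomp ε hε
  refine ⟨δ, hδ, fun n s ξ hs h0 hn hsδ hξ => ?_⟩
  refine le_of_tendsto ((tendsto_const_nhds.sub hJ).norm) ?_
  filter_upwards [h] with k hk
  exact (hk n s ξ hs h0 hn hsδ hξ).le

end HilbertIntegral

/-! ### Norm bounds and integrals over the whole line -/

section HilbertIntegralBounds

variable {H : Type*} [NormedAddCommGroup H] [InnerProductSpace ℝ H]

lemma uniformGrid_of_le {A B : ℝ} {n i : ℕ} (h : n + 1 ≤ i) : uniformGrid A B n i = B := by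
  have h' : uniformGrid A B n i = uniformGrid A B n (n + 1) := by
    simp only [uniformGrid, min_eq_right h, min_self]
  rw [h', uniformGrid_last]

/-- `variationIntegral` is a supremum of sums with the infimum over each cell. On a fine grid the
corner value of `g ⊗ g` exceeds that infimum by at most `ε`, which costs `ε V` in total. -/
lemma eventually_sum_uniformGrid_le {Γ : ℝ → ℝ → ℝ} {V : ℝ} (hV : GridVariationLE Γ V)
    {g : ℝ → ℝ} (hg : Continuous g) {W : ℝ} (hW0 : 0 ≤ W)
    (hW : variationIntegral Γ (fun l m => ENNReal.ofReal (g l * g m)) ≤ ENNReal.ofReal W)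
    {A B : ℝ} (hAB : A ≤ B) {ε : ℝ} (hε : 0 < ε) :
    ∀ᶠ n : ℕ in atTop, ∑ i ∈ Finset.range (n + 1), ∑ j ∈ Finset.range (n + 1),
      g (uniformGrid A B n i) * g (uniformGrid A B n j) *
        |rectIncrement Γ (uniformGrid A B n i) (uniformGrid A B n (i + 1))
          (uniformGrid A B n j) (uniformGrid A B n (j + 1))| ≤ W + ε * V := by
  have hGc : ContinuousOn (fun z : ℝ × ℝ => g z.1 * g z.2) (Icc A B ×ˢ Icc A B) := by fun_prop
  obtain ⟨δ, hδ, hG⟩ := Metric.uniformContinuousOn_iff.1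
    ((isCompact_Icc.prod isCompact_Icc).uniformContinuousOn_of_continuous hGc) ε hε
  filter_upwards [eventually_uniformGrid_mesh_lt A B hδ] with n hn
  have hmono := uniformGrid_monotone hAB n
  have hmem : ∀ i, uniformGrid A B n i ∈ Icc A B := fun i =>
    ⟨by simpa [uniformGrid_zero] using hmono (Nat.zero_le i), by
      rcases le_total i (n + 1) with h | h
      · simpa [uniformGrid_last] using hmono h
      · exact (uniformGrid_of_le h).le⟩
  set s := uniformGrid A B n
  set r : ℕ → ℕ → ℝ := fun i j => |rectIncrement Γ (s i) (s (i + 1)) (s j) (s (j + 1))|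
  have hr : ∀ i j, 0 ≤ r i j := fun i j => abs_nonneg _
  have hlow : ∑ i ∈ Finset.range (n + 1), ∑ j ∈ Finset.range (n + 1),
      -- The truncation at `0` keeps the summands nonnegative, so that the sum can be moved into
      -- `ℝ≥0∞` term by term.
      max (g (s i) * g (s j) - ε) 0 * r i j ≤ W := by
    rw [← ENNReal.ofReal_le_ofReal_iff hW0]
    refine le_trans ?_ hW
    rw [ENNReal.ofReal_sum_of_nonneg fun i _ => Finset.sum_nonneg fun j _ =>
      mul_nonneg (le_max_right _ _) (hr i j)]
    refine le_trans ?_ (le_iSup₂_of_le (n + 1) (n + 1) (le_iSup₂_of_le s s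
      (le_iSup₂_of_le hmono hmono le_rfl)))
    refine Finset.sum_le_sum fun i hi => ?_
    rw [ENNReal.ofReal_sum_of_nonneg fun j _ => mul_nonneg (le_max_right _ _) (hr i j)]
    refine Finset.sum_le_sum fun j hj => ?_
    rw [ENNReal.ofReal_mul (le_max_right _ _)]
    refine mul_le_mul_left ?_ _
    refine le_iInf₂ fun u hu => le_iInf₂ fun v hv => ?_
    rw [ENNReal.ofReal_max, ENNReal.ofReal_zero, max_eq_left zero_le]
    refine ENNReal.ofReal_le_ofReal ?_
    rw [Finset.mem_range] at hi hj
    have hi' := uniformGrid_succ_sub (A := A) (B := B) n hi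
    have hj' := uniformGrid_succ_sub (A := A) (B := B) n hj
    have hd : dist ((s i, s j) : ℝ × ℝ) (u, v) < δ := by
      rw [Prod.dist_eq, max_lt_iff, Real.dist_eq, Real.dist_eq, abs_lt, abs_lt]
      refine ⟨⟨?_, ?_⟩, ?_, ?_⟩ <;> simp only <;> linarith [hu.1, hu.2, hv.1, hv.2]
    have := hG (s i, s j) ⟨hmem i, hmem j⟩ (u, v)
      ⟨⟨(hmem i).1.trans hu.1, hu.2.trans (hmem _).2⟩,
        (hmem j).1.trans hv.1, hv.2.trans (hmem _).2⟩ hd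
    rw [Real.dist_eq] at this
    linarith [(abs_lt.1 this).2]
  calc ∑ i ∈ Finset.range (n + 1), ∑ j ∈ Finset.range (n + 1), g (s i) * g (s j) * r i j
      ≤ ∑ i ∈ Finset.range (n + 1), ∑ j ∈ Finset.range (n + 1),
        (max (g (s i) * g (s j) - ε) 0 * r i j + ε * r i j) := by
        refine Finset.sum_le_sum fun i _ => Finset.sum_le_sum fun j _ => ?_
        rw [← add_mul]
        refine mul_le_mul_of_nonneg_right ?_ (hr i j)
        linarith [le_max_left (g (s i) * g (s j) - ε) 0]
    _ ≤ W + ε * V := by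
        simp only [Finset.sum_add_distrib, ← Finset.mul_sum]
        exact add_le_add hlow (mul_le_mul_of_nonneg_left
          (hV (n + 1) s fun i _ => hmono (Nat.le_succ i)) hε.le)

/-- The splitting is made in the Riemann sums, so `f₁` and `f₂` need not be continuous or integrable
separately. The triangle inequality in `H` avoids any bound on mixed terms between the two parts. -/
lemma IsStieltjesIntegralOn.norm_le {Y : ℝ → H} {V : ℝ} (hV : GridVariationLE (gramKernel Y) V)
    {f f₁ f₂ g : ℝ → ℝ} (hg : Continuous g) {W : ℝ} (hW0 : 0 ≤ W)
    (hW : variationIntegral (gramKernel Y) (fun l m => ENNReal.ofReal (g l * g m))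
      ≤ ENNReal.ofReal W) {A B M c : ℝ} (hAB : A ≤ B) (hM : 0 ≤ M) (hc : 0 ≤ c)
    (hf : ∀ x ∈ Icc A B, f x = f₁ x + f₂ x) (hf₁ : ∀ x ∈ Icc A B, |f₁ x| ≤ M)
    (hf₂ : ∀ x ∈ Icc A B, |f₂ x| ≤ c * g x) {J : H} (hJ : IsStieltjesIntegralOn f Y A B J) :
    ‖J‖ ≤ M * √V + c * √W := by
  have key : ∀ ε : ℝ, 0 < ε → ‖J‖ ≤ M * √V + c * √(W + ε * V) := by
    intro ε hε
    refine le_of_tendsto (hJ.tendsto_uniformGrid hAB).norm ?_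
    filter_upwards [eventually_sum_uniformGrid_le hV hg hW0 hW hAB hε] with n hn
    have hmono := uniformGrid_monotone hAB n
    have hmem : ∀ i ≤ n + 1, uniformGrid A B n i ∈ Icc A B := fun i hi =>
      ⟨by simpa [uniformGrid_zero] using hmono (Nat.zero_le i),
        by simpa [uniformGrid_last] using hmono hi⟩
    set s := uniformGrid A B n
    have hsplit : stieltjesSum f Y (n + 1) s s =
        ∑ i ∈ Finset.range (n + 1), f₁ (s i) • (Y (s (i + 1)) - Y (s i)) +
        ∑ i ∈ Finset.range (n + 1), f₂ (s i) • (Y (s (i + 1)) - Y (s i)) := by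
      rw [← Finset.sum_add_distrib]
      refine Finset.sum_congr rfl fun i hi => ?_
      rw [← add_smul, ← hf _ (hmem i (Finset.mem_range.1 hi).le)]
    rw [hsplit]
    refine (norm_add_le _ _).trans (add_le_add ?_ ?_)
    · exact norm_sum_smul_le_of_le hV (fun i _ => hmono (Nat.le_succ i)) hM
        fun i hi => hf₁ _ (hmem i hi.le)
    · have h1 := (norm_sq_sum_smul_le Y (n + 1) s fun i => f₂ (s i))
      have h2 : ‖∑ i ∈ Finset.range (n + 1), f₂ (s i) • (Y (s (i + 1)) - Y (s i))‖ ^ 2 ≤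
          c ^ 2 * (W + ε * V) := by
        refine h1.trans (le_trans ?_ (mul_le_mul_of_nonneg_left hn (sq_nonneg c)))
        rw [Finset.mul_sum]
        refine Finset.sum_le_sum fun i hi => ?_
        rw [Finset.mul_sum]
        refine Finset.sum_le_sum fun j hj => ?_
        have hi' := hf₂ _ (hmem i (Finset.mem_range.1 hi).le)
        have hj' := hf₂ _ (hmem j (Finset.mem_range.1 hj).le)
        rw [← mul_assoc]
        refine mul_le_mul_of_nonneg_right ?_ (abs_nonneg _)
        refine (mul_le_mul hi' hj' (abs_nonneg _) ((abs_nonneg _).trans hi')).trans (le_of_eq ?_)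
        ring
      have h3 := Real.sqrt_le_sqrt h2
      rwa [Real.sqrt_sq (norm_nonneg _), Real.sqrt_mul (sq_nonneg c), Real.sqrt_sq hc] at h3
  have hcont : Continuous fun ε : ℝ => M * √V + c * √(W + ε * V) := by fun_prop
  have hlim : Tendsto (fun ε : ℝ => M * √V + c * √(W + ε * V)) (𝓝[>] 0)
      (𝓝 (M * √V + c * √W)) := by
    have := (hcont.tendsto 0).mono_left (nhdsWithin_le_nhds (s := Ioi 0))
    simpa using this
  refine ge_of_tendsto hlim ?_
  filter_upwards [self_mem_nhdsWithin] with ε hε using key ε hε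

lemma IsStieltjesIntegralOn.add_adjacent {f : ℝ → ℝ} {Y : ℝ → H} {A B C : ℝ} (hAB : A ≤ B)
    (hBC : B ≤ C) {J₁ J₂ J₃ : H} (h₁ : IsStieltjesIntegralOn f Y A B J₁)
    (h₂ : IsStieltjesIntegralOn f Y B C J₂) (h₃ : IsStieltjesIntegralOn f Y A C J₃) :
    J₃ = J₁ + J₂ := by
  have hlim := (h₁.tendsto_uniformGrid hAB).add (h₂.tendsto_uniformGrid hBC)
  refine tendsto_nhds_unique ?_ hlim
  rw [Metric.tendsto_nhds]
  intro ε hε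
  obtain ⟨δ, hδ, h⟩ := h₃ (ε / 2) (by positivity)
  filter_upwards [eventually_uniformGrid_mesh_lt A B hδ, eventually_uniformGrid_mesh_lt B C hδ]
    with n hn1 hn2
  -- The two grids are concatenated in one formula: up to index `n + 1` the truncated subtraction
  -- makes the second term `B`, and afterwards the first term is constantly `B`.
  let s : ℕ → ℝ := fun i => uniformGrid A B n i + uniformGrid B C n (i - (n + 1)) - B
  have hmono : Monotone s := by
    intro i j hij
    have h1 := uniformGrid_monotone hAB n hij
    have h2 := uniformGrid_monotone hBC n (Nat.sub_le_sub_right hij (n + 1))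
    simp only [s]; linarith
  have hs1 : ∀ i ≤ n + 1, s i = uniformGrid A B n i := by
    intro i hi
    simp only [s, Nat.sub_eq_zero_of_le hi, uniformGrid_zero]; ring
  have hs2 : ∀ i, s (n + 1 + i) = uniformGrid B C n i := by
    intro i
    simp only [s, Nat.add_sub_cancel_left]
    rw [uniformGrid_of_le (Nat.le_add_right _ _)]; ring
  have hsum : stieltjesSum f Y (n + 1 + (n + 1)) s s =
      stieltjesSum f Y (n + 1) (uniformGrid A B n) (uniformGrid A B n) +
      stieltjesSum f Y (n + 1) (uniformGrid B C n) (uniformGrid B C n) := by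
    unfold stieltjesSum
    rw [Finset.sum_range_add]
    congr 1
    · refine Finset.sum_congr rfl fun i hi => ?_
      rw [Finset.mem_range] at hi
      rw [hs1 i hi.le, hs1 (i + 1) hi]
    · refine Finset.sum_congr rfl fun i hi => ?_
      rw [hs2, add_assoc, hs2]
  rw [← hsum, dist_eq_norm]
  refine lt_of_le_of_lt (h _ s s hmono ?_ ?_ (fun i hi => ?_) fun i _ =>
    ⟨le_rfl, hmono (Nat.le_succ i)⟩) (by linarith)
  · rw [hs1 0 (Nat.zero_le _), uniformGrid_zero]
  · rw [hs2, uniformGrid_last]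
  · rcases lt_or_ge i (n + 1) with h' | h'
    · rw [hs1 i h'.le, hs1 (i + 1) h', uniformGrid_succ_sub n h']; exact hn1
    · obtain ⟨k, rfl⟩ := Nat.exists_eq_add_of_le h'
      rw [hs2, add_assoc, hs2, uniformGrid_succ_sub n (by omega)]; exact hn2

/-- `J = ∫_{-∞}^{∞} f dY` as the limit of the integrals over `[A, B]`. -/
def IsStieltjesIntegral (f : ℝ → ℝ) (Y : ℝ → H) (J : H) : Prop :=
  ∃ K : ℝ → ℝ → H, (∀ A B : ℝ, A ≤ B → IsStieltjesIntegralOn f Y A B (K A B)) ∧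
    Tendsto (fun p : ℝ × ℝ => K p.1 p.2) (atBot ×ˢ atTop) (𝓝 J)

lemma eventually_fst_le_snd : ∀ᶠ p : ℝ × ℝ in atBot ×ˢ atTop, p.1 ≤ p.2 := by
  filter_upwards [prod_mem_prod (Iic_mem_atBot (0 : ℝ)) (Ici_mem_atTop (0 : ℝ))] with p hp
  exact le_trans hp.1 hp.2

/-- Where `|x| ≥ R` one has `|f x| ≤ 1 ≤ R^{-q} |x|^q`, so the integral over an interval outside
`(-R, R)` has norm at most `R^{-q} √W`. Hence the integrals over growing intervals are Cauchy. -/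
lemma exists_isStieltjesIntegral [CompleteSpace H] {Y : ℝ → H} {V : ℝ}
    (hV : GridVariationLE (gramKernel Y) V) {f : ℝ → ℝ} (hf : Continuous f)
    (hf1 : ∀ x, |f x| ≤ 1) {q : ℝ} (hq : 0 < q) {W : ℝ} (hW0 : 0 ≤ W)
    (hW : variationIntegral (gramKernel Y) (fun l m => ENNReal.ofReal (|l| ^ q * |m| ^ q))
      ≤ ENNReal.ofReal W) : ∃ J, IsStieltjesIntegral f Y J := by
  have hex : ∀ A B : ℝ, ∃ J, A ≤ B → IsStieltjesIntegralOn f Y A B J := by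
    intro A B
    by_cases h : A ≤ B
    · obtain ⟨J, hJ⟩ := exists_isStieltjesIntegralOn hV hf h
      exact ⟨J, fun _ => hJ⟩
    · exact ⟨0, fun h' => absurd h' h⟩
  choose K hK using hex
  have hg : Continuous fun x : ℝ => |x| ^ q := continuous_abs.rpow_const fun x => Or.inr hq.le
  have htail : ∀ R : ℝ, 0 < R → ∀ A B, A ≤ B → (∀ x ∈ Icc A B, R ≤ |x|) →
      ‖K A B‖ ≤ R ^ (-q) * √W := by
    intro R hR A B hAB hRx
    have := (hK A B hAB).norm_le hV hg hW0 hW hAB (M := 0) (c := R ^ (-q)) le_rfl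
      (Real.rpow_nonneg hR.le _) (f₁ := fun _ => 0) (f₂ := f) (fun x _ => by simp)
      (fun x _ => by simp) (fun x hx => ?_)
    · simpa using this
    · refine (hf1 x).trans ?_
      rw [Real.rpow_neg hR.le, inv_mul_eq_div, one_le_div (Real.rpow_pos_of_pos hR q)]
      exact Real.rpow_le_rpow hR.le (hRx x hx) hq.le
  have hdiff : ∀ R : ℝ, 0 < R → ∀ A B, A ≤ -R → R ≤ B →
      ‖K A B - K (-R) R‖ ≤ 2 * (R ^ (-q) * √W) := by
    intro R hR A B hA hB
    have h1 := (hK A (-R) hA).add_adjacent hA (by linarith : -R ≤ B) (hK (-R) B (by linarith))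
      (hK A B (by linarith))
    have h2 := (hK (-R) R (by linarith)).add_adjacent (by linarith) hB (hK R B hB)
      (hK (-R) B (by linarith))
    have h3 : K A B - K (-R) R = K A (-R) + K R B := by rw [h1, h2]; abel
    rw [h3]
    have h4 := htail R hR A (-R) hA fun x hx => by
      rw [abs_of_nonpos (by linarith [hx.2])]; linarith [hx.2]
    have h5 := htail R hR R B hB fun x hx => hx.1.trans (le_abs_self x)
    linarith [norm_add_le (K A (-R)) (K R B)]
  have hlim0 : Tendsto (fun R : ℝ => 2 * (R ^ (-q) * √W)) atTop (𝓝 0) := by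
    have := ((tendsto_rpow_neg_atTop hq).mul_const (√W)).const_mul 2
    simpa using this
  have hlim1 : Tendsto (fun n : ℕ => 2 * (((n : ℝ) + 1) ^ (-q) * √W)) atTop (𝓝 0) :=
    hlim0.comp (tendsto_atTop_add_const_right _ 1 tendsto_natCast_atTop_atTop)
  have hcau : CauchySeq fun n : ℕ => K (-((n : ℝ) + 1)) ((n : ℝ) + 1) := by
    rw [Metric.cauchySeq_iff']
    intro ε hε
    obtain ⟨N, hN⟩ := (hlim1.eventually (gt_mem_nhds hε)).exists
    refine ⟨N, fun n hn => ?_⟩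
    have hn' : (N : ℝ) ≤ n := by exact_mod_cast hn
    rw [dist_eq_norm]
    exact lt_of_le_of_lt (hdiff _ (by positivity) _ _ (by linarith) (by linarith)) hN
  obtain ⟨J, hJ⟩ := cauchySeq_tendsto_of_complete hcau
  refine ⟨J, K, fun A B h => hK A B h, ?_⟩
  rw [Metric.tendsto_nhds]
  intro ε hε
  have hε2 : 0 < ε / 2 := by positivity
  obtain ⟨N, hN1, hN2⟩ := ((hlim1.eventually (gt_mem_nhds hε2)).and
    ((Metric.tendsto_nhds.1 hJ) _ hε2)).exists
  filter_upwards [prod_mem_prod (Iic_mem_atBot (-((N : ℝ) + 1))) (Ici_mem_atTop ((N : ℝ) + 1))]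
    with p hp
  have h1 := hdiff _ (by positivity) p.1 p.2 hp.1 hp.2
  rw [← dist_eq_norm] at h1
  linarith [dist_triangle (K p.1 p.2) (K (-((N : ℝ) + 1)) ((N : ℝ) + 1)) J]

lemma IsStieltjesIntegral.norm_le {Y : ℝ → H} {V : ℝ} (hV : GridVariationLE (gramKernel Y) V)
    {f f₁ f₂ g : ℝ → ℝ} (hg : Continuous g) {W : ℝ} (hW0 : 0 ≤ W)
    (hW : variationIntegral (gramKernel Y) (fun l m => ENNReal.ofReal (g l * g m))
      ≤ ENNReal.ofReal W) {M c : ℝ} (hM : 0 ≤ M) (hc : 0 ≤ c)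
    (hf : ∀ x, f x = f₁ x + f₂ x) (hf₁ : ∀ x, |f₁ x| ≤ M)
    (hf₂ : ∀ x, |f₂ x| ≤ c * g x) {J : H} (hJ : IsStieltjesIntegral f Y J) :
    ‖J‖ ≤ M * √V + c * √W := by
  obtain ⟨K, hK, hlim⟩ := hJ
  refine le_of_tendsto hlim.norm ?_
  filter_upwards [eventually_fst_le_snd] with p hp
  exact (hK p.1 p.2 hp).norm_le hV hg hW0 hW hp hM hc (fun x _ => hf x) (fun x _ => hf₁ x)
    fun x _ => hf₂ x

lemma stieltjesSum_sub (f f' : ℝ → ℝ) (Y : ℝ → H) (n : ℕ) (s ξ : ℕ → ℝ) :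
    stieltjesSum (fun x => f x - f' x) Y n s ξ =
      stieltjesSum f Y n s ξ - stieltjesSum f' Y n s ξ := by
  simp only [stieltjesSum, sub_smul, Finset.sum_sub_distrib]

lemma IsStieltjesIntegralOn.sub {f f' : ℝ → ℝ} {Y : ℝ → H} {A B : ℝ} {J J' : H}
    (h : IsStieltjesIntegralOn f Y A B J) (h' : IsStieltjesIntegralOn f' Y A B J') :
    IsStieltjesIntegralOn (fun x => f x - f' x) Y A B (J - J') := by
  intro ε hε
  obtain ⟨δ, hδ, H1⟩ := h (ε / 2) (by positivity)
  obtain ⟨δ', hδ', H2⟩ := h' (ε / 2) (by positivity)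
  refine ⟨min δ δ', lt_min hδ hδ', fun n s ξ hs h0 hn hm hξ => ?_⟩
  have h1 := H1 n s ξ hs h0 hn (fun i hi => (hm i hi).trans_le (min_le_left _ _)) hξ
  have h2 := H2 n s ξ hs h0 hn (fun i hi => (hm i hi).trans_le (min_le_right _ _)) hξ
  rw [stieltjesSum_sub, sub_sub_sub_comm]
  linarith [norm_sub_le (stieltjesSum f Y n s ξ - J) (stieltjesSum f' Y n s ξ - J')]

lemma IsStieltjesIntegral.sub {f f' : ℝ → ℝ} {Y : ℝ → H} {J J' : H}
    (h : IsStieltjesIntegral f Y J) (h' : IsStieltjesIntegral f' Y J') :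
    IsStieltjesIntegral (fun x => f x - f' x) Y (J - J') := by
  obtain ⟨K, hK, hlim⟩ := h
  obtain ⟨K', hK', hlim'⟩ := h'
  exact ⟨fun A B => K A B - K' A B, fun A B hAB => (hK A B hAB).sub (hK' A B hAB),
    hlim.sub hlim'⟩

lemma stieltjesSum_mem_span (f : ℝ → ℝ) (Y : ℝ → H) (n : ℕ) (s ξ : ℕ → ℝ) :
    stieltjesSum f Y n s ξ ∈ Submodule.span ℝ (Set.range Y) :=
  Submodule.sum_mem _ fun _ _ => Submodule.smul_mem _ _ (Submodule.sub_mem _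
    (Submodule.subset_span ⟨_, rfl⟩) (Submodule.subset_span ⟨_, rfl⟩))

lemma IsStieltjesIntegral.mem_closure_span {f : ℝ → ℝ} {Y : ℝ → H} {J : H}
    (h : IsStieltjesIntegral f Y J) :
    J ∈ closure (Submodule.span ℝ (Set.range Y) : Set H) := by
  obtain ⟨K, hK, hlim⟩ := h
  refine isClosed_closure.mem_of_tendsto hlim ?_
  filter_upwards [eventually_fst_le_snd] with p hp
  exact isClosed_closure.mem_of_tendsto ((hK p.1 p.2 hp).tendsto_uniformGrid hp)
    (Eventually.of_forall fun n => subset_closure (stieltjesSum_mem_span _ _ _ _ _))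

end HilbertIntegralBounds

/-! ### Mean-square integrals as integrals in `L²`, and sub-Gaussian standards -/

section MeanSquare

variable {Ω : Type*} [MeasurableSpace Ω] {P : Measure Ω}

/-- A second-order process as a curve in `L²`. -/
noncomputable def toL2 {y : ℝ → Ω → ℝ} (hy : ∀ s, MemLp (y s) 2 P) (s : ℝ) : Lp ℝ 2 P :=
  (hy s).toLp (y s)

lemma gramKernel_toL2 {y : ℝ → Ω → ℝ} (hy : ∀ s, MemLp (y s) 2 P) :
    gramKernel (toL2 hy) = covFun y P := by
  funext s t
  rw [gramKernel, covFun, L2.inner_def]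
  refine integral_congr_ae ?_
  filter_upwards [(hy s).coeFn_toLp, (hy t).coeFn_toLp] with ω h1 h2
  simp only [toL2, h1, h2, RCLike.inner_apply, conj_trivial]
  ring

lemma ofReal_norm_eq_eLpNorm (v : Lp ℝ 2 P) : ENNReal.ofReal ‖v‖ = eLpNorm v 2 P := by
  rw [Lp.norm_def, ENNReal.ofReal_toReal (Lp.eLpNorm_ne_top v)]

lemma eLpNorm_sub_eq_ofReal_norm {ζ J : Ω → ℝ} {v : Lp ℝ 2 P} (hζ : ζ =ᵐ[P] v)
    (hJ : MemLp J 2 P) :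
    eLpNorm (fun ω => ζ ω - J ω) 2 P = ENNReal.ofReal ‖v - hJ.toLp J‖ := by
  rw [ofReal_norm_eq_eLpNorm]
  refine eLpNorm_congr_ae ?_
  filter_upwards [hζ, hJ.coeFn_toLp, Lp.coeFn_sub v (hJ.toLp J)] with ω h1 h2 h3
  rw [h3, Pi.sub_apply, h1, h2]

lemma sum_ae_eq_stieltjesSum {y : ℝ → Ω → ℝ} (hy : ∀ s, MemLp (y s) 2 P) (f : ℝ → ℝ) (n : ℕ)
    (s ξ : ℕ → ℝ) :
    (fun ω => ∑ i ∈ Finset.range n, f (ξ i) * (y (s (i + 1)) ω - y (s i) ω)) =ᵐ[P]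
      (stieltjesSum f (toL2 hy) n s ξ : Lp ℝ 2 P) := by
  induction n with
  | zero =>
    simp only [stieltjesSum, Finset.range_zero, Finset.sum_empty]
    exact (Lp.coeFn_zero ℝ 2 P).symm
  | succ n ih =>
    have h : stieltjesSum f (toL2 hy) (n + 1) s ξ = stieltjesSum f (toL2 hy) n s ξ +
        f (ξ n) • (toL2 hy (s (n + 1)) - toL2 hy (s n)) := Finset.sum_range_succ _ _
    rw [h]
    filter_upwards [ih, Lp.coeFn_add (stieltjesSum f (toL2 hy) n s ξ)
      (f (ξ n) • (toL2 hy (s (n + 1)) - toL2 hy (s n))),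
      Lp.coeFn_smul (f (ξ n)) (toL2 hy (s (n + 1)) - toL2 hy (s n)),
      Lp.coeFn_sub (toL2 hy (s (n + 1))) (toL2 hy (s n)),
      (hy (s (n + 1))).coeFn_toLp, (hy (s n)).coeFn_toLp] with ω h1 h2 h3 h4 h5 h6
    rw [Finset.sum_range_succ, h1, h2, Pi.add_apply, h3, Pi.smul_apply, h4, Pi.sub_apply]
    simp only [toL2, h5, h6, smul_eq_mul]

lemma isMeanSquareIntegralOn_iff {y : ℝ → Ω → ℝ} (hy : ∀ s, MemLp (y s) 2 P) {f : ℝ → ℝ}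
    {A B : ℝ} {J : Ω → ℝ} : IsMeanSquareIntegralOn f y A B J P ↔
      ∃ hJ : MemLp J 2 P, IsStieltjesIntegralOn f (toL2 hy) A B (hJ.toLp J) := by
  constructor
  · rintro ⟨hJ, h⟩
    refine ⟨hJ, fun ε hε => ?_⟩
    obtain ⟨δ, hδ, H⟩ := h (ENNReal.ofReal ε) (ENNReal.ofReal_pos.2 hε)
    refine ⟨δ, hδ, fun n s ξ hs h0 hn hm hξ => ?_⟩
    have := H n s ξ hs h0 hn hm hξ
    rwa [eLpNorm_sub_eq_ofReal_norm (sum_ae_eq_stieltjesSum hy f n s ξ) hJ,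
      ENNReal.ofReal_le_ofReal_iff hε.le] at this
  · rintro ⟨hJ, h⟩
    refine ⟨hJ, fun ε hε => ?_⟩
    rcases eq_or_ne ε ∞ with rfl | hε'
    · exact ⟨1, one_pos, fun _ _ _ _ _ _ _ _ => le_top⟩
    obtain ⟨δ, hδ, H⟩ := h ε.toReal (ENNReal.toReal_pos hε.ne' hε')
    refine ⟨δ, hδ, fun n s ξ hs h0 hn hm hξ => ?_⟩
    rw [eLpNorm_sub_eq_ofReal_norm (sum_ae_eq_stieltjesSum hy f n s ξ) hJ]
    exact ENNReal.ofReal_le_of_le_toReal (H n s ξ hs h0 hn hm hξ)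

lemma isMeanSquareIntegral_iff {y : ℝ → Ω → ℝ} (hy : ∀ s, MemLp (y s) 2 P) {f : ℝ → ℝ}
    {J : Ω → ℝ} : IsMeanSquareIntegral f y J P ↔
      ∃ hJ : MemLp J 2 P, IsStieltjesIntegral f (toL2 hy) (hJ.toLp J) := by
  constructor
  · rintro ⟨hJ, K, hK, hlim⟩
    have hK' : ∀ A B, A ≤ B → ∃ hk : MemLp (K A B) 2 P,
        IsStieltjesIntegralOn f (toL2 hy) A B (hk.toLp (K A B)) := fun A B h =>
      (isMeanSquareIntegralOn_iff hy).1 (hK A B h)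
    -- Only pairs with `A ≤ B` carry an integral; the value `0` elsewhere is harmless because the
    -- filter eventually lies in `A ≤ B`.
    refine ⟨hJ, fun A B => if h : A ≤ B then (hK' A B h).choose.toLp (K A B) else 0, ?_, ?_⟩
    · intro A B h
      simp only [dif_pos h]
      exact (hK' A B h).choose_spec
    · rw [tendsto_iff_norm_sub_tendsto_zero]
      have h1 := (ENNReal.tendsto_toReal ENNReal.zero_ne_top).comp hlim
      refine h1.congr' ?_
      filter_upwards [eventually_fst_le_snd] with p hp
      simp only [dif_pos hp, Function.comp]
      rw [eLpNorm_sub_eq_ofReal_norm (hK' p.1 p.2 hp).choose.coeFn_toLp.symm hJ,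
        ENNReal.toReal_ofReal (norm_nonneg _)]
  · rintro ⟨hJ, K, hK, hlim⟩
    refine ⟨hJ, fun A B => K A B, fun A B h => (isMeanSquareIntegralOn_iff hy).2
      ⟨Lp.memLp _, by rw [Lp.toLp_coeFn]; exact hK A B h⟩, ?_⟩
    rw [tendsto_iff_norm_sub_tendsto_zero] at hlim
    have h1 := ENNReal.tendsto_ofReal hlim
    rw [ENNReal.ofReal_zero] at h1
    refine h1.congr fun p => ?_
    rw [eLpNorm_sub_eq_ofReal_norm (EventuallyEq.refl _ _) hJ]

lemma IsMeanSquareIntegral.congr {y : ℝ → Ω → ℝ} {f : ℝ → ℝ} {J J' : Ω → ℝ}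
    (h : IsMeanSquareIntegral f y J P) (hJ : J =ᵐ[P] J') : IsMeanSquareIntegral f y J' P := by
  obtain ⟨h1, K, hK, hlim⟩ := h
  refine ⟨h1.ae_eq hJ, K, hK, hlim.congr fun p => eLpNorm_congr_ae ?_⟩
  filter_upwards [hJ] with ω hω
  rw [hω]

/-- `E exp(l ζ) ≤ exp(φ(a l))` for all `l`. -/
def ExpMomentLE (φ : ℝ → ℝ) (a : ℝ) (ζ : Ω → ℝ) (P : Measure Ω) : Prop :=
  ∀ l : ℝ, ∫⁻ ω, ENNReal.ofReal (Real.exp (l * ζ ω)) ∂P ≤ ENNReal.ofReal (Real.exp (φ (a * l)))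

lemma continuous_powerOrlicz {α : ℝ} (hα : 0 < α) : Continuous (powerOrlicz α) :=
  (continuous_abs.rpow_const fun _ => Or.inr hα.le).div_const α

lemma powerOrlicz_mul_mono {α : ℝ} (hα : 0 < α) {a a' : ℝ} (ha : 0 ≤ a) (h : a ≤ a') (l : ℝ) :
    powerOrlicz α (a * l) ≤ powerOrlicz α (a' * l) := by
  unfold powerOrlicz
  have : |a * l| ≤ |a' * l| := by
    rw [abs_mul, abs_mul, abs_of_nonneg ha, abs_of_nonneg (ha.trans h)]
    gcongr
  gcongr

lemma ExpMomentLE.mono {α : ℝ} (hα : 0 < α) {a a' : ℝ} {ζ : Ω → ℝ}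
    (h : ExpMomentLE (powerOrlicz α) a ζ P) (ha : 0 ≤ a) (haa : a ≤ a') :
    ExpMomentLE (powerOrlicz α) a' ζ P := fun l =>
  (h l).trans (ENNReal.ofReal_le_ofReal (Real.exp_le_exp.2 (powerOrlicz_mul_mono hα ha haa l)))

/-- Admissible constants are upward closed, and by continuity of `φ` the bound also holds at the
infimum. This includes `a = 0`, although the infimum runs over positive constants only. -/
lemma subGaussianStandard_le_ofReal_iff {α : ℝ} (hα : 0 < α) {a : ℝ} (ha : 0 ≤ a) {ζ : Ω → ℝ} :
    subGaussianStandard (powerOrlicz α) ζ P ≤ ENNReal.ofReal a ↔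
      ExpMomentLE (powerOrlicz α) a ζ P := by
  constructor
  · intro h l
    have hcont : Continuous fun ε : ℝ => ENNReal.ofReal (Real.exp (powerOrlicz α ((a + ε) * l))) :=
      ENNReal.continuous_ofReal.comp (Real.continuous_exp.comp
        ((continuous_powerOrlicz hα).comp (by fun_prop)))
    have hlim := (hcont.tendsto 0).mono_left (nhdsWithin_le_nhds (s := Ioi 0))
    rw [add_zero] at hlim
    refine ge_of_tendsto hlim ?_
    filter_upwards [self_mem_nhdsWithin] with ε hε
    have hε : 0 < ε := hε
    have hlt : subGaussianStandard (powerOrlicz α) ζ P < ENNReal.ofReal (a + ε) :=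
      h.trans_lt ((ENNReal.ofReal_lt_ofReal_iff (by linarith)).2 (by linarith))
    obtain ⟨b, hb⟩ := iInf_lt_iff.1 hlt
    obtain ⟨⟨hb0, hb1⟩, hb2⟩ := iInf_lt_iff.1 hb
    have hb3 := (ENNReal.ofReal_lt_ofReal_iff (by linarith)).1 hb2
    exact ExpMomentLE.mono hα hb1 hb0.le hb3.le l
  · intro h
    refine ENNReal.le_of_forall_pos_le_add fun ε hε _ => ?_
    have hε' : (0 : ℝ) < ε := hε
    refine (iInf₂_le (a + ε) ⟨by linarith, h.mono hα ha (by linarith)⟩).trans ?_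
    rw [ENNReal.ofReal_add ha hε'.le, ENNReal.ofReal_coe_nnreal]

lemma ExpMomentLE.congr {φ : ℝ → ℝ} {a : ℝ} {ζ ζ' : Ω → ℝ} (h : ExpMomentLE φ a ζ P)
    (hζ : ζ =ᵐ[P] ζ') : ExpMomentLE φ a ζ' P := fun l => by
  refine le_trans (le_of_eq ?_) (h l)
  refine lintegral_congr_ae ?_
  filter_upwards [hζ] with ω hω
  rw [hω]

/-- Fatou's lemma for `exp(l ζₙ)`, with continuity of `φ` for the right-hand side. -/
lemma ExpMomentLE.of_tendsto_ae {φ : ℝ → ℝ} (hφ : Continuous φ) {ζ : ℕ → Ω → ℝ} {ζ' : Ω → ℝ}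
    (hm : ∀ n, AEMeasurable (ζ n) P) {a : ℕ → ℝ} {a' : ℝ} (h : ∀ n, ExpMomentLE φ (a n) (ζ n) P)
    (hζ : ∀ᵐ ω ∂P, Tendsto (fun n => ζ n ω) atTop (𝓝 (ζ' ω))) (ha : Tendsto a atTop (𝓝 a')) :
    ExpMomentLE φ a' ζ' P := by
  intro l
  have hcont : ∀ g : ℝ → ℝ, Continuous g →
      Continuous fun x => ENNReal.ofReal (Real.exp (g x)) := fun g hg =>
    ENNReal.continuous_ofReal.comp (Real.continuous_exp.comp hg)
  calc ∫⁻ ω, ENNReal.ofReal (Real.exp (l * ζ' ω)) ∂P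
      = ∫⁻ ω, liminf (fun n => ENNReal.ofReal (Real.exp (l * ζ n ω))) atTop ∂P := by
        refine lintegral_congr_ae ?_
        filter_upwards [hζ] with ω hω
        exact (((hcont _ (continuous_const_mul l)).tendsto _).comp hω).liminf_eq.symm
    _ ≤ liminf (fun n => ∫⁻ ω, ENNReal.ofReal (Real.exp (l * ζ n ω)) ∂P) atTop :=
        lintegral_liminf_le' fun n =>
          (ENNReal.measurable_ofReal.comp Real.measurable_exp).comp_aemeasurable
            ((hm n).const_mul l)
    _ ≤ liminf (fun n => ENNReal.ofReal (Real.exp (φ (a n * l)))) atTop :=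
        liminf_le_liminf (Eventually.of_forall fun n => h n l)
    _ = ENNReal.ofReal (Real.exp (φ (a' * l))) :=
        (((hcont _ (hφ.comp (continuous_mul_const l))).tendsto _).comp ha).liminf_eq

lemma memLp_two_of_expMomentLE [IsFiniteMeasure P] {φ : ℝ → ℝ} {a : ℝ} {ζ : Ω → ℝ}
    (hm : AEMeasurable ζ P) (h : ExpMomentLE φ a ζ P) : MemLp ζ 2 P := by
  have hexp : ∀ l : ℝ, Integrable (fun ω => Real.exp (l * ζ ω)) P := fun l => by
    have hl : AEStronglyMeasurable (fun ω => Real.exp (l * ζ ω)) P :=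
      (Real.measurable_exp.comp_aemeasurable (hm.const_mul l)).aestronglyMeasurable
    rw [← lintegral_ofReal_ne_top_iff_integrable hl
      (Eventually.of_forall fun ω => (Real.exp_pos _).le)]
    exact ((h l).trans_lt ENNReal.ofReal_lt_top).ne
  rw [memLp_two_iff_integrable_sq hm.aestronglyMeasurable]
  refine (((hexp 1).add (hexp (-1))).const_mul 2).mono' (hm.pow_const 2).aestronglyMeasurable
    (Eventually.of_forall fun ω => ?_)
  rw [Real.norm_eq_abs, abs_of_nonneg (sq_nonneg _), Pi.add_apply, one_mul, neg_one_mul]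
  have h1 := Real.quadratic_le_exp_of_nonneg (abs_nonneg (ζ ω))
  rw [sq_abs] at h1
  have h2 : Real.exp |ζ ω| ≤ Real.exp (ζ ω) + Real.exp (-ζ ω) := by
    rcases abs_cases (ζ ω) with ⟨h, _⟩ | ⟨h, _⟩ <;> rw [h] <;>
      linarith [Real.exp_pos (ζ ω), Real.exp_pos (-ζ ω)]
  linarith [abs_nonneg (ζ ω)]

lemma IsStrictlyPhiSubGaussian.memLp [IsFiniteMeasure P] {φ : ℝ → ℝ} {y : ℝ → Ω → ℝ} {C : ℝ≥0}
    (h : IsStrictlyPhiSubGaussian φ y C P) (s : ℝ) : MemLp (y s) 2 P := by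
  obtain ⟨a, -, ha⟩ := (h.subGaussian s).exp_bound
  exact memLp_two_of_expMomentLE (h.subGaussian s).aemeasurable fun l => by
    rw [mul_comm]; exact ha l

lemma IsStrictlyPhiSubGaussian.expMomentLE_of_mem_span {α : ℝ} (hα : 0 < α) {y : ℝ → Ω → ℝ}
    {C : ℝ≥0} (h : IsStrictlyPhiSubGaussian (powerOrlicz α) y C P) (hy : ∀ s, MemLp (y s) 2 P)
    {v : Lp ℝ 2 P} (hv : v ∈ Submodule.span ℝ (Set.range (toL2 hy))) :
    ExpMomentLE (powerOrlicz α) (C * ‖v‖) v P := by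
  obtain ⟨c, rfl⟩ := (Finsupp.mem_span_range_iff_exists_finsupp).1 hv
  have hae : (fun ω => ∑ u ∈ c.support, c u * y u ω) =ᵐ[P]
      (c.sum fun u b => b • toL2 hy u : Lp ℝ 2 P) := by
    rw [Finsupp.sum]
    have h1 : ∀ᵐ ω ∂P, ∀ u ∈ c.support, (c u • toL2 hy u : Lp ℝ 2 P) ω = c u * y u ω := by
      rw [Finset.eventually_all]
      intro u _
      filter_upwards [Lp.coeFn_smul (c u) (toL2 hy u), (hy u).coeFn_toLp] with ω h1 h2
      rw [h1, Pi.smul_apply, smul_eq_mul]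
      simp only [toL2, h2]
    filter_upwards [h1, Lp.coeFn_finsetSum c.support fun u => c u • toL2 hy u] with ω h1 h2
    rw [h2, Finset.sum_apply]
    exact Finset.sum_congr rfl fun u hu => (h1 u hu).symm
  refine ExpMomentLE.congr ?_ hae
  rw [← subGaussianStandard_le_ofReal_iff hα (by positivity)]
  refine (h.standard_le c.support c).trans (le_of_eq ?_)
  rw [ENNReal.ofReal_mul (NNReal.coe_nonneg C), ofReal_norm_eq_eLpNorm, eLpNorm_congr_ae hae,
    ENNReal.ofReal_coe_nnreal]

/-- An `L²` limit of linear combinations is an almost sure limit along a subsequence, and the norms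
converge too, so the exponential bounds survive. -/
lemma IsStrictlyPhiSubGaussian.expMomentLE_of_mem_closure {α : ℝ} (hα : 0 < α) {y : ℝ → Ω → ℝ}
    {C : ℝ≥0} (h : IsStrictlyPhiSubGaussian (powerOrlicz α) y C P) (hy : ∀ s, MemLp (y s) 2 P)
    {v : Lp ℝ 2 P} (hv : v ∈ closure (Submodule.span ℝ (Set.range (toL2 hy)) : Set (Lp ℝ 2 P))) :
    ExpMomentLE (powerOrlicz α) (C * ‖v‖) v P := by
  obtain ⟨w, hw, hlim⟩ := mem_closure_iff_seq_limit.1 hv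
  obtain ⟨ns, hns, hae⟩ := (tendstoInMeasure_of_tendsto_Lp hlim).exists_seq_tendsto_ae
  exact ExpMomentLE.of_tendsto_ae (continuous_powerOrlicz hα) (ζ := fun n => w (ns n))
    (fun n => (Lp.aestronglyMeasurable _).aemeasurable)
    (fun n => h.expMomentLE_of_mem_span hα hy (hw (ns n))) hae
    ((hlim.comp hns.tendsto_atTop).norm.const_mul _)

end MeanSquare

/-! ### Finite nets in a rectangle, for the maximum metric -/

lemma exists_net_Icc {a b h : ℝ} (hab : a ≤ b) (hh : 0 < h) {n : ℕ} (hn : 1 ≤ n)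
    (hl : b - a ≤ 2 * n * h) :
    ∃ S : Finset ℝ, (∀ x ∈ S, x ∈ Icc a b) ∧ S.card ≤ n ∧ ∀ x ∈ Icc a b, ∃ z ∈ S, |x - z| ≤ h := by
  induction n, hn using Nat.le_induction generalizing a with
  | base =>
    refine ⟨{(a + b) / 2}, ?_, by simp, fun x hx => ⟨_, Finset.mem_singleton_self _, ?_⟩⟩
    · simp only [Finset.mem_singleton, forall_eq]; constructor <;> linarith
    · push_cast at hl
      rw [abs_le]; constructor <;> linarith [hx.1, hx.2]
  | succ n hn ih =>
    classical
    rcases le_total b (a + 2 * h) with hb | hb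
    · refine ⟨{(a + b) / 2}, ?_, by simp, fun x hx => ⟨_, Finset.mem_singleton_self _, ?_⟩⟩
      · simp only [Finset.mem_singleton, forall_eq]; constructor <;> linarith
      · rw [abs_le]; constructor <;> linarith [hx.1, hx.2]
    · push_cast at hl
      obtain ⟨S, hS1, hS2, hS3⟩ := ih hb (by linarith)
      refine ⟨insert (a + h) S, fun x hx => ?_, (Finset.card_insert_le _ _).trans (by omega),
        fun x hx => ?_⟩
      · rcases Finset.mem_insert.1 hx with rfl | hx
        · constructor <;> linarith
        · have := hS1 x hx; exact ⟨by linarith [this.1], this.2⟩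
      · rcases le_total x (a + 2 * h) with h' | h'
        · refine ⟨a + h, Finset.mem_insert_self _ _, ?_⟩
          rw [abs_le]; constructor <;> linarith [hx.1]
        · obtain ⟨z, hz, hz'⟩ := hS3 x ⟨h', hx.2⟩
          exact ⟨z, Finset.mem_insert_of_mem hz, hz'⟩

lemma exists_net_rectangle {a b c d h : ℝ} (hab : a ≤ b) (hcd : c ≤ d) (hh : 0 < h) :
    ∃ V : Finset (ℝ × ℝ), (∀ p ∈ V, p ∈ Icc a b ×ˢ Icc c d) ∧
      (V.card : ℝ) ≤ ((b - a) / (2 * h) + 1) * ((d - c) / (2 * h) + 1) ∧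
      ∀ p ∈ Icc a b ×ˢ Icc c d, ∃ q ∈ V, dist p q ≤ h := by
  have key : ∀ {a b : ℝ}, a ≤ b → ∃ S : Finset ℝ, (∀ x ∈ S, x ∈ Icc a b) ∧
      (S.card : ℝ) ≤ (b - a) / (2 * h) + 1 ∧ ∀ x ∈ Icc a b, ∃ z ∈ S, |x - z| ≤ h := by
    intro a b hab
    have h0 : 0 ≤ (b - a) / (2 * h) := div_nonneg (sub_nonneg.2 hab) (by positivity)
    obtain ⟨S, h1, h2, h3⟩ := exists_net_Icc hab hh (n := ⌊(b - a) / (2 * h)⌋₊ + 1)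
      (Nat.le_add_left 1 _) (by
        have := (Nat.lt_floor_add_one ((b - a) / (2 * h))).le
        rw [div_le_iff₀ (by positivity)] at this
        push_cast
        linarith)
    refine ⟨S, h1, ?_, h3⟩
    have h4 : (S.card : ℝ) ≤ (⌊(b - a) / (2 * h)⌋₊ + 1 : ℕ) := by exact_mod_cast h2
    push_cast at h4
    linarith [Nat.floor_le h0]
  obtain ⟨S, hS1, hS2, hS3⟩ := key hab
  obtain ⟨T, hT1, hT2, hT3⟩ := key hcd
  refine ⟨S ×ˢ T, fun p hp => ?_, ?_, fun p hp => ?_⟩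
  · rw [Finset.mem_product] at hp
    exact ⟨hS1 _ hp.1, hT1 _ hp.2⟩
  · rw [Finset.card_product]
    push_cast
    exact mul_le_mul hS2 hT2 (Nat.cast_nonneg _) ((Nat.cast_nonneg _).trans hS2)
  · obtain ⟨z, hz, hz'⟩ := hS3 p.1 hp.1
    obtain ⟨w, hw, hw'⟩ := hT3 p.2 hp.2
    exact ⟨(z, w), Finset.mem_product.2 ⟨hz, hw⟩, max_le hz' hw'⟩

/-! ### Continuous averages over a net -/

section NetAverage

variable {E : Type*} [PseudoMetricSpace E]

/-- The average of `x` over the points of `V` at distance less than `2 h` from `p`, with weights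
`2 h - dist p q`. -/
noncomputable def netAverage (V : Finset E) (h : ℝ) (x : E → ℝ) (p : E) : ℝ :=
  (∑ q ∈ V, max 0 (2 * h - dist p q) * x q) / ∑ q ∈ V, max 0 (2 * h - dist p q)

lemma sum_netAverage_weight_pos {V : Finset E} {h : ℝ} (hh : 0 < h) {p : E}
    (hp : ∃ q ∈ V, dist p q ≤ h) : 0 < ∑ q ∈ V, max 0 (2 * h - dist p q) := by
  obtain ⟨q, hq, hd⟩ := hp
  exact Finset.sum_pos' (fun _ _ => le_max_left _ _) ⟨q, hq, lt_max_of_lt_right (by linarith)⟩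

lemma abs_netAverage_sub_le {V : Finset E} {h : ℝ} (hh : 0 < h) {p : E}
    (hp : ∃ q ∈ V, dist p q ≤ h) {x : E → ℝ} {z r : ℝ}
    (hx : ∀ q ∈ V, dist p q < 2 * h → |x q - z| ≤ r) : |netAverage V h x p - z| ≤ r := by
  have hpos := sum_netAverage_weight_pos hh hp
  have h1 : netAverage V h x p - z = (∑ q ∈ V, max 0 (2 * h - dist p q) * (x q - z)) /
      ∑ q ∈ V, max 0 (2 * h - dist p q) := by
    rw [netAverage, eq_div_iff hpos.ne', sub_mul, div_mul_cancel₀ _ hpos.ne']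
    simp only [mul_sub, Finset.sum_sub_distrib, ← Finset.sum_mul]
    ring
  rw [h1, abs_div, abs_of_pos hpos, div_le_iff₀ hpos, Finset.mul_sum]
  refine (Finset.abs_sum_le_sum_abs _ _).trans (Finset.sum_le_sum fun q hq => ?_)
  rw [abs_mul, abs_of_nonneg (le_max_left _ _), mul_comm]
  rcases lt_or_ge (dist p q) (2 * h) with hd | hd
  · exact mul_le_mul_of_nonneg_right (hx q hq hd) (le_max_left _ _)
  · rw [max_eq_left (by linarith), mul_zero, mul_zero]

/-- Only net points within `2 h` and `2 h'` of `p` have positive weight, so a difference of averages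
at any `p` is controlled by finitely many increments. The bound is therefore uniform in `p`. -/
lemma abs_netAverage_sub_netAverage_le {V V' : Finset E} {h h' : ℝ} (hh : 0 < h) (hh' : 0 < h')
    {p : E} (hp : ∃ q ∈ V, dist p q ≤ h) (hp' : ∃ q ∈ V', dist p q ≤ h') {x : E → ℝ} {r : ℝ}
    (hx : ∀ q ∈ V, ∀ q' ∈ V', dist q q' < 2 * h + 2 * h' → |x q - x q'| ≤ r) :
    |netAverage V h x p - netAverage V' h' x p| ≤ r := by
  rw [abs_sub_comm]
  refine abs_netAverage_sub_le hh' hp' fun q' hq' hd' => ?_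
  rw [abs_sub_comm]
  refine abs_netAverage_sub_le hh hp fun q hq hd => hx q hq q' hq' ?_
  linarith [dist_triangle_left q q' p]

lemma continuousOn_netAverage {V : Finset E} {h : ℝ} (hh : 0 < h) {D : Set E}
    (hV : ∀ p ∈ D, ∃ q ∈ V, dist p q ≤ h) (x : E → ℝ) :
    ContinuousOn (netAverage V h x) D := by
  refine ContinuousOn.div ?_ ?_ fun p hp => (sum_netAverage_weight_pos hh (hV p hp)).ne'
  · fun_prop
  · fun_prop

end NetAverage

/-! ### Tail bounds and the continuous modification -/

section ExpMoment

variable {Ω : Type*} [MeasurableSpace Ω] {P : Measure Ω}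

lemma powerOrlicz_neg (α x : ℝ) : powerOrlicz α (-x) = powerOrlicz α x := by
  simp only [powerOrlicz, abs_neg]

lemma ExpMomentLE.neg {α a : ℝ} {ζ : Ω → ℝ} (h : ExpMomentLE (powerOrlicz α) a ζ P) :
    ExpMomentLE (powerOrlicz α) a (fun ω => -ζ ω) P := fun l => by
  have := h (-l)
  rw [mul_neg, powerOrlicz_neg] at this
  simpa only [neg_mul, mul_neg] using this

lemma aemeasurable_ofReal_exp {ζ : Ω → ℝ} (hζ : AEMeasurable ζ P) :
    AEMeasurable (fun ω => ENNReal.ofReal (Real.exp (ζ ω))) P :=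
  (ENNReal.measurable_ofReal.comp Real.measurable_exp).comp_aemeasurable hζ

lemma ExpMomentLE.lintegral_exp_abs_le {α a : ℝ} {ζ : Ω → ℝ} (hm : AEMeasurable ζ P)
    (h : ExpMomentLE (powerOrlicz α) a ζ P) (l : ℝ) :
    ∫⁻ ω, ENNReal.ofReal (Real.exp (l * |ζ ω|)) ∂P ≤
      ENNReal.ofReal (2 * Real.exp (powerOrlicz α (a * l))) := by
  calc ∫⁻ ω, ENNReal.ofReal (Real.exp (l * |ζ ω|)) ∂P
      ≤ ∫⁻ ω, (ENNReal.ofReal (Real.exp (l * ζ ω)) + ENNReal.ofReal (Real.exp (l * -ζ ω))) ∂P := by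
        refine lintegral_mono fun ω => ?_
        rcases abs_choice (ζ ω) with h' | h' <;> simp only [h']
        · exact le_self_add
        · exact le_add_self
    _ ≤ _ := by
        rw [lintegral_add_left' (aemeasurable_ofReal_exp (hm.const_mul l)), two_mul,
          ENNReal.ofReal_add (Real.exp_pos _).le (Real.exp_pos _).le]
        exact add_le_add (h l) (h.neg l)

lemma ExpMomentLE.measure_abs_gt_le {α a : ℝ} (ha : 0 < a) {ζ : Ω → ℝ} (hm : AEMeasurable ζ P)
    (h : ExpMomentLE (powerOrlicz α) a ζ P) (r : ℝ) :
    P {ω | r < |ζ ω|} ≤ ENNReal.ofReal (2 * Real.exp (powerOrlicz α 1) * Real.exp (-(r / a))) := by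
  have h1 := h.lintegral_exp_abs_le hm a⁻¹
  rw [mul_inv_cancel₀ ha.ne'] at h1
  have h2 := mul_meas_ge_le_lintegral₀
    (aemeasurable_ofReal_exp (P := P) ((hm.abs).const_mul a⁻¹)) (ENNReal.ofReal (Real.exp (r / a)))
  rw [Real.exp_neg, ← div_eq_mul_inv, ENNReal.ofReal_div_of_pos (Real.exp_pos _),
    ENNReal.le_div_iff_mul_le (Or.inl (ENNReal.ofReal_pos.2 (Real.exp_pos _)).ne')
      (Or.inl ENNReal.ofReal_ne_top), mul_comm]
  refine le_trans ?_ (h2.trans h1)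
  refine mul_le_mul_right (measure_mono fun ω hω => ?_) _
  have hω : r < |ζ ω| := hω
  change ENNReal.ofReal (Real.exp (r / a)) ≤ ENNReal.ofReal (Real.exp (a⁻¹ * |ζ ω|))
  rw [div_eq_inv_mul]
  gcongr

/-- Borel-Cantelli: at threshold `k log 32` times the scale of the increment, each tail is of order
`32^{-k}`. At most `C 16^k` pairs leave a summable `2^{-k}`. -/
lemma ae_eventually_abs_sub_le {E : Type*} {α ρ : ℝ} {X : E → Ω → ℝ}
    (hX : ∀ p, AEMeasurable (X p) P) {S : ℕ → Finset (E × E)} {C K : ℝ} (hK : 0 < K)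
    (hcard : ∀ k, ((S k).card : ℝ) ≤ C * 16 ^ k)
    (hS : ∀ k, ∀ z ∈ S k, ExpMomentLE (powerOrlicz α) (K * ((2 : ℝ) ^ (-ρ)) ^ k)
      (fun ω => X z.1 ω - X z.2 ω) P) :
    ∀ᵐ ω ∂P, ∀ᶠ k in atTop, ∀ z ∈ S k,
      |X z.1 ω - X z.2 ω| ≤ Real.log 32 * K * (k * ((2 : ℝ) ^ (-ρ)) ^ k) := by
  set r : ℕ → ℝ := fun k => Real.log 32 * K * (k * ((2 : ℝ) ^ (-ρ)) ^ k)
  set M : ℝ := 2 * Real.exp (powerOrlicz α 1)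
  have hM : 0 ≤ M := by positivity
  have hb : (0 : ℝ) < 2 ^ (-ρ) := by positivity
  have hle : ∀ k, P (⋃ z ∈ S k, {ω | r k < |X z.1 ω - X z.2 ω|}) ≤
      ENNReal.ofReal (C * M * (1 / 2) ^ k) := by
    intro k
    refine (measure_biUnion_finset_le _ _).trans ?_
    have h1 : ∀ z ∈ S k, P {ω | r k < |X z.1 ω - X z.2 ω|} ≤
        ENNReal.ofReal (M * (1 / 32) ^ k) := by
      intro z hz
      refine ((hS k z hz).measure_abs_gt_le (by positivity) ((hX _).sub (hX _)) (r k)).trans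
        (le_of_eq ?_)
      congr 2
      have : r k / (K * ((2 : ℝ) ^ (-ρ)) ^ k) = k * Real.log 32 := by
        simp only [r]; field_simp
      rw [this, Real.exp_neg, Real.exp_nat_mul, Real.exp_log (by norm_num), one_div, inv_pow]
    refine (Finset.sum_le_sum h1).trans ?_
    rw [Finset.sum_const, nsmul_eq_mul, ← ENNReal.ofReal_natCast,
      ← ENNReal.ofReal_mul (Nat.cast_nonneg _)]
    refine ENNReal.ofReal_le_ofReal ?_
    refine (mul_le_mul_of_nonneg_right (hcard k) (by positivity)).trans (le_of_eq ?_)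
    have : (1 / 2 : ℝ) ^ k = 16 ^ k * (1 / 32) ^ k := by rw [← mul_pow]; norm_num
    rw [this]; ring
  have hsum : ∑' k, P (⋃ z ∈ S k, {ω | r k < |X z.1 ω - X z.2 ω|}) ≠ ∞ := by
    refine ((ENNReal.tsum_le_tsum hle).trans_lt ?_).ne
    exact ((summable_geometric_two.mul_left (C * M)).tsum_ofReal_lt_top)
  filter_upwards [ae_eventually_notMem hsum] with ω hω
  filter_upwards [hω] with k hk z hz
  by_contra hlt
  exact hk (mem_biUnion hz (not_le.1 hlt))

/-- The averages over nets of mesh `2^{-k}` are continuous on the rectangle. Almost surely their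
successive differences are eventually bounded, uniformly in the point, by a summable sequence, and
at each fixed point they converge almost surely to `X`. The uniform limit is the modification. -/
lemma exists_continuous_modification {α ρ : ℝ} (hρ : 0 < ρ) {a b c d : ℝ} (hab : a ≤ b)
    (hcd : c ≤ d) {X : ℝ × ℝ → Ω → ℝ} (hX : ∀ p, AEMeasurable (X p) P) {K : ℝ} (hK : 0 < K)
    (hinc : ∀ p ∈ Icc a b ×ˢ Icc c d, ∀ q ∈ Icc a b ×ˢ Icc c d, ∀ h : ℝ, 0 < h → dist p q ≤ h →
      ExpMomentLE (powerOrlicz α) (K * h ^ ρ) (fun ω => X p ω - X q ω) P) :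
    ∃ U : ℝ × ℝ → Ω → ℝ, (∀ p ∈ Icc a b ×ˢ Icc c d, X p =ᵐ[P] U p) ∧
      HasContinuousPathsOn (Icc a b ×ˢ Icc c d) U P := by
  set D : Set (ℝ × ℝ) := Icc a b ×ˢ Icc c d
  set g : ℕ → ℝ := fun k => (1 / 2) ^ k
  have hg : ∀ k, 0 < g k := fun k => by positivity
  have hg1 : ∀ k, g k ≤ 1 := fun k => pow_le_one₀ (by norm_num) (by norm_num)
  have hgρ : ∀ k, g k ^ ρ = ((2 : ℝ) ^ (-ρ)) ^ k := by
    intro k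
    simp only [g]
    rw [← Real.rpow_natCast, ← Real.rpow_natCast, ← Real.rpow_mul (by norm_num),
      ← Real.rpow_mul (by norm_num), one_div, Real.inv_rpow (by norm_num),
      ← Real.rpow_neg (by norm_num)]
    congr 1; ring
  set C : ℝ := (b - a + 1) * (d - c + 1)
  have hba : 0 ≤ b - a := sub_nonneg.2 hab
  have hdc : 0 ≤ d - c := sub_nonneg.2 hcd
  have hC : 1 ≤ C := by simp only [C]; nlinarith [mul_nonneg hba hdc]
  have hnet : ∀ k, ∃ V : Finset (ℝ × ℝ), (∀ p ∈ V, p ∈ D) ∧ (V.card : ℝ) ≤ C * 4 ^ k ∧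
      ∀ p ∈ D, ∃ q ∈ V, dist p q ≤ g k := by
    intro k
    obtain ⟨V, h1, h2, h3⟩ := exists_net_rectangle hab hcd (hg k)
    refine ⟨V, h1, h2.trans ?_, h3⟩
    have h4 : ∀ x : ℝ, 0 ≤ x → x / (2 * g k) + 1 ≤ (x + 1) * 2 ^ k := by
      intro x hx
      have : x / (2 * g k) = x * 2 ^ k / 2 := by
        simp only [g, one_div, inv_pow]; field_simp
      rw [this]
      have h5 : (1 : ℝ) ≤ 2 ^ k := one_le_pow₀ (by norm_num)
      nlinarith [mul_nonneg hx (by positivity : (0 : ℝ) ≤ 2 ^ k)]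
    refine (mul_le_mul (h4 _ hba) (h4 _ hdc) (by have := hg k; positivity)
      (by positivity)).trans (le_of_eq ?_)
    have : (4 : ℝ) ^ k = 2 ^ k * 2 ^ k := by rw [← mul_pow]; norm_num
    rw [this]; simp only [C]; ring
  choose V hVD hVc hVn using hnet
  set A : ℕ → ℝ × ℝ → Ω → ℝ := fun k p ω => netAverage (V k) (g k) (fun q => X q ω) p
  -- Relevant pairs are closer than `2 g k + 2 g (k+1) = 3 g k`; the radius `4 g k` is used, hence
  -- the factor `4 ^ ρ`.
  set K' : ℝ := K * 4 ^ ρ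
  have hK' : 0 < K' := by positivity
  set r : ℕ → ℝ := fun k => Real.log 32 * K' * (k * ((2 : ℝ) ^ (-ρ)) ^ k)
  have hr : Summable r := by
    refine Summable.mul_left _ ?_
    have := summable_pow_mul_geometric_of_norm_lt_one (R := ℝ) 1 (r := (2 : ℝ) ^ (-ρ)) (by
      rw [Real.norm_eq_abs, abs_of_pos (by positivity)]
      exact Real.rpow_lt_one_of_one_lt_of_neg (by norm_num) (by linarith))
    simpa using this
  have hmom : ∀ k, ∀ p ∈ D, ∀ q ∈ D, dist p q ≤ 4 * g k →
      ExpMomentLE (powerOrlicz α) (K' * ((2 : ℝ) ^ (-ρ)) ^ k) (fun ω => X p ω - X q ω) P := by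
    intro k p hp q hq hd
    have := hinc p hp q hq (4 * g k) (by have := hg k; positivity) hd
    rwa [Real.mul_rpow (by norm_num) (hg k).le, hgρ, ← mul_assoc] at this
  have hgs : ∀ k, g (k + 1) = g k / 2 := fun k => by simp only [g, pow_succ]; ring
  have hstep : ∀ᵐ ω ∂P, ∀ᶠ k in atTop, ∀ p ∈ D, ‖A (k + 1) p ω - A k p ω‖ ≤ r k := by
    have := ae_eventually_abs_sub_le (α := α) (ρ := ρ) hX
      (S := fun k => ((V k) ×ˢ (V (k + 1))).filter fun z => dist z.1 z.2 ≤ 4 * g k)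
      -- The number of pairs is at most `C 4^k · C 4^(k+1) = 4 C² 16^k`.
      (C := 4 * C ^ 2) (K := K') hK' (fun k => ?_) (fun k z hz => ?_)
    · filter_upwards [this] with ω hω
      filter_upwards [hω] with k hk p hp
      rw [Real.norm_eq_abs, abs_sub_comm]
      refine abs_netAverage_sub_netAverage_le (hg k) (hg (k + 1)) (hVn k p hp)
        (hVn (k + 1) p hp) fun q hq q' hq' hd => hk (q, q') ?_
      refine Finset.mem_filter.2 ⟨Finset.mem_product.2 ⟨hq, hq'⟩, ?_⟩
      rw [hgs] at hd
      simp only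
      linarith [hg k]
    · refine (Nat.cast_le.2 (Finset.card_filter_le _ _)).trans ?_
      rw [Finset.card_product]
      push_cast
      refine (mul_le_mul (hVc k) (hVc (k + 1)) (Nat.cast_nonneg _) (by positivity)).trans
        (le_of_eq ?_)
      have : (16 : ℝ) ^ k = 4 ^ k * 4 ^ k := by rw [← mul_pow]; norm_num
      rw [this, pow_succ]; ring
    · obtain ⟨h1, h2⟩ := Finset.mem_filter.1 hz
      rw [Finset.mem_product] at h1
      exact hmom k _ (hVD k _ h1.1) _ (hVD (k + 1) _ h1.2) h2
  have hpt : ∀ p ∈ D, ∀ᵐ ω ∂P, Tendsto (fun k => A k p ω) atTop (𝓝 (X p ω)) := by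
    intro p hp
    have := ae_eventually_abs_sub_le (α := α) (ρ := ρ) hX
      (S := fun k => ((V k) ×ˢ {p}).filter fun z => dist z.1 z.2 ≤ 4 * g k)
      (C := C) (K := K') hK' (fun k => ?_) (fun k z hz => ?_)
    · filter_upwards [this] with ω hω
      rw [tendsto_iff_norm_sub_tendsto_zero]
      refine squeeze_zero' (Eventually.of_forall fun k => norm_nonneg _) ?_
        hr.tendsto_atTop_zero
      filter_upwards [hω] with k hk
      refine abs_netAverage_sub_le (hg k) (hVn k p hp) fun q hq hd => hk (q, p) ?_
      refine Finset.mem_filter.2 ⟨Finset.mem_product.2 ⟨hq, Finset.mem_singleton_self _⟩, ?_⟩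
      simp only
      rw [dist_comm]
      linarith [hg k]
    · refine (Nat.cast_le.2 (Finset.card_filter_le _ _)).trans ?_
      rw [Finset.card_product, Finset.card_singleton, mul_one]
      refine (hVc k).trans (mul_le_mul_of_nonneg_left ?_ (by positivity))
      gcongr
      norm_num
    · obtain ⟨h1, h2⟩ := Finset.mem_filter.1 hz
      rw [Finset.mem_product, Finset.mem_singleton] at h1
      exact hmom k _ (hVD k _ h1.1) _ (h1.2 ▸ hp) h2
  have hunif : ∀ᵐ ω ∂P, TendstoUniformlyOn
      (fun n p => ∑ k ∈ Finset.range n, (A (k + 1) p ω - A k p ω))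
      (fun p => ∑' k, (A (k + 1) p ω - A k p ω)) atTop D := by
    filter_upwards [hstep] with ω hω
    exact tendstoUniformlyOn_tsum_nat_eventually hr hω
  refine ⟨fun p ω => A 0 p ω + ∑' k, (A (k + 1) p ω - A k p ω), fun p hp => ?_, ?_⟩
  · filter_upwards [hunif, hpt p hp] with ω h1 h2
    have h3 := (h1.tendsto_at hp)
    simp only [Finset.sum_range_sub (fun k => A k p ω)] at h3
    have h4 := tendsto_nhds_unique h3 (h2.sub_const (A 0 p ω))
    rw [h4]; ring
  · filter_upwards [hunif] with ω h1
    have hcont : ∀ k, ContinuousOn (fun p => A k p ω) D := fun k =>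
      continuousOn_netAverage (hg k) (hVn k) _
    refine (hcont 0).add (h1.continuousOn (Frequently.of_forall fun n => ?_))
    exact continuousOn_finsetSum _ fun k _ => (hcont (k + 1)).sub (hcont k)

end ExpMoment

/-! ### Chaining bound for the supremum -/

section Chaining

variable {Ω : Type*} [MeasurableSpace Ω] {P : Measure Ω}

/-- Jensen's inequality for `exp`; the mass `θ ^ K` missing from the truncated geometric weights is
placed at the point `0`. -/
lemma exp_sum_geometric_weight_le {θ : ℝ} (hθ0 : 0 ≤ θ) (hθ1 : θ < 1) (K : ℕ) (z : ℕ → ℝ) :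
    Real.exp (∑ k ∈ Finset.range K, (1 - θ) * θ ^ k * z k) ≤
      ∑ k ∈ Finset.range K, (1 - θ) * θ ^ k * Real.exp (z k) + θ ^ K := by
  have hw : ∑ k ∈ Finset.range K, (1 - θ) * θ ^ k + θ ^ K = 1 := by
    rw [← Finset.mul_sum, mul_neg_geom_sum]; ring
  have h := convexOn_exp.map_sum_le (t := Finset.range (K + 1))
    (w := fun k => if k < K then (1 - θ) * θ ^ k else θ ^ K) (p := fun k => if k < K then z k else 0)
    (fun k _ => by
      have : 0 ≤ 1 - θ := by linarith
      split_ifs <;> positivity)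
    (by
      rw [Finset.sum_range_succ, if_neg (lt_irrefl K)]
      refine Eq.trans ?_ hw
      congr 1
      exact Finset.sum_congr rfl fun k hk => if_pos (Finset.mem_range.1 hk)) (fun _ _ => mem_univ _)
  simp only [smul_eq_mul] at h
  rw [Finset.sum_range_succ, Finset.sum_range_succ] at h
  simp only [lt_irrefl, if_false, mul_zero, add_zero, Real.exp_zero, mul_one] at h
  refine le_trans (le_of_eq ?_) (h.trans (le_of_eq ?_))
  · congr 1
    refine Finset.sum_congr rfl fun k hk => ?_
    rw [if_pos (Finset.mem_range.1 hk), if_pos (Finset.mem_range.1 hk)]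
  · congr 1
    refine Finset.sum_congr rfl fun k hk => ?_
    rw [if_pos (Finset.mem_range.1 hk), if_pos (Finset.mem_range.1 hk)]

/-- Plays the part of Hölder's inequality for `∏ S_k^{w_k}`: after dividing each `S k` by `exp (c
k)`, Jensen bounds the weighted product by an average of expectation at most `1`, and Markov's
inequality finishes. -/
lemma measure_le_sum_geometric_weight_log_le [IsProbabilityMeasure P] {θ : ℝ} (hθ0 : 0 ≤ θ)
    (hθ1 : θ < 1) (K : ℕ) {S : ℕ → Ω → ℝ} (hS : ∀ k < K, ∀ ω, 0 < S k ω)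
    (hm : ∀ k < K, AEMeasurable (S k) P) {c : ℕ → ℝ}
    (hc : ∀ k < K, ∫⁻ ω, ENNReal.ofReal (S k ω) ∂P ≤ ENNReal.ofReal (Real.exp (c k))) {T : ℝ}
    (hT : ∑ k ∈ Finset.range K, (1 - θ) * θ ^ k * c k ≤ T) (v : ℝ) :
    P {ω | v ≤ ∑ k ∈ Finset.range K, (1 - θ) * θ ^ k * Real.log (S k ω)} ≤
      ENNReal.ofReal (Real.exp (T - v)) := by
  have h1θ : 0 ≤ 1 - θ := by linarith
  have hw0 : ∀ k, 0 ≤ (1 - θ) * θ ^ k := fun k => by positivity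
  let W : Ω → ℝ≥0∞ := fun ω => ∑ k ∈ Finset.range K,
    ENNReal.ofReal ((1 - θ) * θ ^ k * Real.exp (-c k)) * ENNReal.ofReal (S k ω) +
      ENNReal.ofReal (θ ^ K)
  have hWle : ∫⁻ ω, W ω ∂P ≤ 1 := by
    simp only [W]
    rw [lintegral_add_right _ measurable_const, lintegral_const, measure_univ, mul_one,
      lintegral_finsetSum' _ fun k hk =>
        ((hm k (Finset.mem_range.1 hk)).ennreal_ofReal).const_mul _]
    have hw : ∑ k ∈ Finset.range K, (1 - θ) * θ ^ k + θ ^ K = 1 := by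
      rw [← Finset.mul_sum, mul_neg_geom_sum]; ring
    have hw' : (1 : ℝ≥0∞) = ENNReal.ofReal (∑ k ∈ Finset.range K, (1 - θ) * θ ^ k + θ ^ K) := by
      rw [hw, ENNReal.ofReal_one]
    rw [hw', ENNReal.ofReal_add (Finset.sum_nonneg fun k _ => hw0 k)
      (by positivity), ENNReal.ofReal_sum_of_nonneg fun k _ => hw0 k]
    gcongr with k hk
    rw [Finset.mem_range] at hk
    rw [lintegral_const_mul' _ _ ENNReal.ofReal_ne_top]
    refine (mul_le_mul_right (hc k hk) _).trans (le_of_eq ?_)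
    rw [← ENNReal.ofReal_mul (mul_nonneg (hw0 k) (Real.exp_pos _).le), mul_assoc, ← Real.exp_add,
      neg_add_cancel, Real.exp_zero, mul_one]
  have hWm : AEMeasurable W P := by
    refine AEMeasurable.add_const (Finset.aemeasurable_fun_sum _ fun k hk => ?_) _
    exact ((hm k (Finset.mem_range.1 hk)).ennreal_ofReal).const_mul _
  have hsub : {ω | v ≤ ∑ k ∈ Finset.range K, (1 - θ) * θ ^ k * Real.log (S k ω)} ⊆
      {ω | ENNReal.ofReal (Real.exp (v - T)) ≤ W ω} := by
    intro ω hω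
    have hω : v ≤ ∑ k ∈ Finset.range K, (1 - θ) * θ ^ k * Real.log (S k ω) := hω
    have h1 := exp_sum_geometric_weight_le hθ0 hθ1 K fun k => Real.log (S k ω) - c k
    have h2 : v - T ≤ ∑ k ∈ Finset.range K, (1 - θ) * θ ^ k * (Real.log (S k ω) - c k) := by
      simp only [mul_sub, Finset.sum_sub_distrib]; linarith
    have h3 := ENNReal.ofReal_le_ofReal ((Real.exp_le_exp.2 h2).trans h1)
    refine h3.trans (le_of_eq ?_)
    rw [ENNReal.ofReal_add (Finset.sum_nonneg fun k _ => mul_nonneg (hw0 k) (Real.exp_pos _).le)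
      (by positivity), ENNReal.ofReal_sum_of_nonneg fun k _ =>
        mul_nonneg (hw0 k) (Real.exp_pos _).le]
    simp only [W]
    congr 1
    refine Finset.sum_congr rfl fun k hk => ?_
    rw [← ENNReal.ofReal_mul (mul_nonneg (hw0 k) (Real.exp_pos _).le), Real.exp_sub,
      Real.exp_log (hS k (Finset.mem_range.1 hk) ω), Real.exp_neg]
    congr 1
    ring
  refine (measure_mono hsub).trans ?_
  refine (meas_ge_le_lintegral_div hWm (ENNReal.ofReal_pos.2 (Real.exp_pos _)).ne'
    ENNReal.ofReal_ne_top).trans ?_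
  refine (ENNReal.div_le_div_right hWle _).trans (le_of_eq ?_)
  rw [← neg_sub v T, Real.exp_neg, ENNReal.ofReal_inv_of_pos (Real.exp_pos _), one_div]

/-- Since `∑ (1 - θ) θ^k k ≤ θ / (1 - θ)` and `-log θ ≤ (1 - θ) / θ`, the logarithmic growth of the
net sizes contributes at most `β`, uniformly in `θ`. With `β = 2 / ρ` this is the source of
`e^{2/ρ}`. -/
lemma sum_geometric_weight_mul_log_le {θ : ℝ} (hθ0 : 0 < θ) (hθ1 : θ < 1) {x β : ℝ} (hx : 0 ≤ x)
    (hβ : 0 ≤ β) (K : ℕ) :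
    ∑ k ∈ Finset.range K, (1 - θ) * θ ^ k * (x + β * (k * -Real.log θ)) ≤ x + β := by
  have h1θ : 0 < 1 - θ := by linarith
  have hsum : ∑ k ∈ Finset.range K, (1 - θ) * θ ^ k ≤ 1 := by
    rw [← Finset.mul_sum, mul_neg_geom_sum]
    linarith [pow_pos hθ0 K]
  have hlog : 0 ≤ -Real.log θ := by linarith [Real.log_nonpos hθ0.le hθ1.le]
  have hθn : ‖θ‖ < 1 := by rwa [Real.norm_eq_abs, abs_of_pos hθ0]
  have hsum2 : ∑ k ∈ Finset.range K, (k : ℝ) * θ ^ k ≤ θ / (1 - θ) ^ 2 := by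
    rw [← tsum_coe_mul_geometric_of_norm_lt_one hθn]
    refine Summable.sum_le_tsum _ (fun k _ => by positivity) ?_
    simpa using summable_pow_mul_geometric_of_norm_lt_one (R := ℝ) 1 hθn
  have hlog2 : -Real.log θ ≤ (1 - θ) / θ := by
    have := Real.log_le_sub_one_of_pos (inv_pos.2 hθ0)
    rw [Real.log_inv] at this
    refine this.trans (le_of_eq ?_)
    field_simp
  calc ∑ k ∈ Finset.range K, (1 - θ) * θ ^ k * (x + β * (k * -Real.log θ))
      = x * ∑ k ∈ Finset.range K, (1 - θ) * θ ^ k +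
        β * ((-Real.log θ) * ((1 - θ) * ∑ k ∈ Finset.range K, (k : ℝ) * θ ^ k)) := by
        simp only [Finset.mul_sum, ← Finset.sum_add_distrib]
        exact Finset.sum_congr rfl fun k _ => by ring
    _ ≤ x * 1 + β * ((1 - θ) / θ * ((1 - θ) * (θ / (1 - θ) ^ 2))) := by gcongr
    _ = x + β := by field_simp

lemma measure_eventually_mem_le {s : ℕ → Set Ω} {c : ℝ≥0∞} (h : ∀ n, P (s n) ≤ c) :
    P {ω | ∀ᶠ n in atTop, ω ∈ s n} ≤ c := by
  have h1 : {ω | ∀ᶠ n in atTop, ω ∈ s n} = ⋃ N, ⋂ n ≥ N, s n := by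
    ext ω
    simp [eventually_atTop]
  rw [h1, Monotone.measure_iUnion]
  · exact iSup_le fun N => (measure_mono (biInter_subset_of_mem (le_refl N))).trans (h N)
  · exact fun N M hNM => biInter_subset_biInter_left fun n (hn : M ≤ n) => hNM.trans hn

lemma powerOrlicz_nonneg {α : ℝ} (hα : 0 ≤ α) (x : ℝ) : 0 ≤ powerOrlicz α x :=
  div_nonneg (Real.rpow_nonneg (abs_nonneg x) α) hα

/-- A point of `V K` is reached through links `ζ k` of standard at most `θ^k E`. With weight `w k =
(1 - θ) θ^k` the moment of `exp (s |ζ k| / w k)` is at most `2 exp φ(E s / (1 - θ))` at every level.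
Replacing the maximum over `V k` by the sum `S k` costs only the cardinality. -/
lemma measure_exists_gt_le_of_chain [IsProbabilityMeasure P] {α : ℝ} (hα : 0 < α) {E θ : ℝ} (hE : 0 < E)
    (hθ0 : 0 < θ) (hθ1 : θ < 1) {T : Type*} {X : T → Ω → ℝ} {V : ℕ → Finset T}
    (hX : ∀ k, ∀ q ∈ V k, AEMeasurable (X q) P) {π : ℕ → T → T} (hne : ∀ k, (V k).Nonempty)
    (hπ : ∀ k, ∀ q ∈ V (k + 1), π k q ∈ V k)
    (h0 : ∀ q ∈ V 0, ExpMomentLE (powerOrlicz α) E (X q) P)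
    (hstep : ∀ k, ∀ q ∈ V (k + 1), ExpMomentLE (powerOrlicz α) (θ ^ (k + 1) * E)
      (fun ω => X q ω - X (π k q) ω) P) {x β : ℝ} (hx : 0 ≤ x) (hβ : 0 ≤ β)
    (hcard : ∀ k, ((V k).card : ℝ) ≤ Real.exp (x + β * (k * -Real.log θ)))
    {s : ℝ} (hs : 0 ≤ s) (u : ℝ) (K : ℕ) :
    P {ω | ∃ q ∈ V K, u < |X q ω|} ≤ ENNReal.ofReal
      (Real.exp (Real.log 2 + powerOrlicz α (E / (1 - θ) * s) + (x + β) - s * u)) := by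
  have h1θ : 0 < 1 - θ := by linarith
  let ζ : ℕ → T → Ω → ℝ := fun k q => match k with
    | 0 => X q
    | k + 1 => fun ω => X q ω - X (π k q) ω
  have hζm : ∀ k, ∀ q ∈ V k, AEMeasurable (ζ k q) P := by
    intro k q hq
    cases k with
    | zero => exact hX 0 q hq
    | succ k => exact (hX _ q hq).sub (hX _ _ (hπ k q hq))
  have hζe : ∀ k, ∀ q ∈ V k, ExpMomentLE (powerOrlicz α) (θ ^ k * E) (ζ k q) P := by
    intro k q hq
    cases k with
    | zero => simpa using h0 q hq
    | succ k => exact hstep k q hq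
  let w : ℕ → ℝ := fun k => (1 - θ) * θ ^ k
  have hw : ∀ k, 0 < w k := fun k => by positivity
  let S : ℕ → Ω → ℝ := fun k ω => ∑ q ∈ V k, Real.exp (s / w k * |ζ k q ω|)
  set y : ℝ := Real.log 2 + powerOrlicz α (E / (1 - θ) * s)
  have hSpos : ∀ k ω, 0 < S k ω := fun k ω =>
    Finset.sum_pos (fun q _ => Real.exp_pos _) (hne k)
  have hSm : ∀ k, AEMeasurable (S k) P := fun k =>
    Finset.aemeasurable_fun_sum _ fun q hq =>
      Real.measurable_exp.comp_aemeasurable ((hζm k q hq).abs.const_mul _)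
  have hSint : ∀ k, ∫⁻ ω, ENNReal.ofReal (S k ω) ∂P ≤
      ENNReal.ofReal (Real.exp (y + (x + β * (k * -Real.log θ)))) := by
    intro k
    have h1 : ∀ ω, ENNReal.ofReal (S k ω) =
        ∑ q ∈ V k, ENNReal.ofReal (Real.exp (s / w k * |ζ k q ω|)) := fun ω =>
      ENNReal.ofReal_sum_of_nonneg fun q _ => (Real.exp_pos _).le
    simp only [h1]
    rw [lintegral_finsetSum' _ fun q hq => aemeasurable_ofReal_exp
      ((hζm k q hq).abs.const_mul _)]
    have h2 : ∀ q ∈ V k, ∫⁻ ω, ENNReal.ofReal (Real.exp (s / w k * |ζ k q ω|)) ∂P ≤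
        ENNReal.ofReal (Real.exp y) := by
      intro q hq
      refine ((hζe k q hq).lintegral_exp_abs_le (hζm k q hq) _).trans (le_of_eq ?_)
      have h3 : θ ^ k * E * (s / w k) = E / (1 - θ) * s := by
        simp only [w]; field_simp
      rw [h3, Real.exp_add, Real.exp_log (by norm_num)]
    refine (Finset.sum_le_sum h2).trans ?_
    rw [Finset.sum_const, nsmul_eq_mul, ← ENNReal.ofReal_natCast,
      ← ENNReal.ofReal_mul (Nat.cast_nonneg _), Real.exp_add y, mul_comm]
    exact ENNReal.ofReal_le_ofReal (mul_le_mul_of_nonneg_left (hcard k) (Real.exp_pos _).le)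
  have hT : ∑ k ∈ Finset.range (K + 1), (1 - θ) * θ ^ k * (y + (x + β * (k * -Real.log θ))) ≤
      max y 0 + (x + β) := by
    have h1 := sum_geometric_weight_mul_log_le hθ0 hθ1
      (add_nonneg (le_max_right y 0) hx) hβ (K + 1)
    rw [add_assoc] at h1
    refine le_trans (Finset.sum_le_sum fun k _ => ?_) h1
    refine mul_le_mul_of_nonneg_left ?_ (hw k).le
    linarith [le_max_left y 0]
  have hchain : ∀ ω k, ∀ q ∈ V k, s * |X q ω| ≤
      ∑ j ∈ Finset.range (k + 1), (1 - θ) * θ ^ j * Real.log (S j ω) := by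
    intro ω
    have hone : ∀ k, ∀ q ∈ V k, s * |ζ k q ω| ≤ (1 - θ) * θ ^ k * Real.log (S k ω) := by
      intro k q hq
      have h1 : s / w k * |ζ k q ω| ≤ Real.log (S k ω) := by
        rw [Real.le_log_iff_exp_le (hSpos k ω)]
        exact Finset.single_le_sum (f := fun q => Real.exp (s / w k * |ζ k q ω|))
          (fun q _ => (Real.exp_pos _).le) hq
      have h2 := mul_le_mul_of_nonneg_left h1 (hw k).le
      refine le_trans (le_of_eq ?_) h2
      have := (hw k).ne'
      field_simp
    intro k
    induction k with
    | zero => intro q hq; simpa using hone 0 q hq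
    | succ k ih =>
      intro q hq
      rw [Finset.sum_range_succ]
      have h1 := ih _ (hπ k q hq)
      have h2 : s * |X q ω - X (π k q) ω| ≤ _ := hone (k + 1) q hq
      have h3 : |X q ω| ≤ |X (π k q) ω| + |X q ω - X (π k q) ω| := by
        have := abs_add_le (X (π k q) ω) (X q ω - X (π k q) ω)
        rwa [add_sub_cancel] at this
      have h4 := mul_le_mul_of_nonneg_left h3 hs
      rw [mul_add] at h4
      linarith
  refine (measure_mono ?_).trans ((measure_le_sum_geometric_weight_log_le hθ0.le hθ1 (K + 1)
    (fun k _ => hSpos k) (fun k _ => hSm k) (fun k _ => hSint k) hT (s * u)).trans ?_)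
  · rintro ω ⟨q, hq, hu⟩
    exact (mul_le_mul_of_nonneg_left hu.le hs).trans (hchain ω K q hq)
  · have hy : 0 ≤ y := add_nonneg (Real.log_nonneg (by norm_num)) (powerOrlicz_nonneg hα.le _)
    rw [max_eq_left hy]

/-- The parameter `(u / B)^(γ - 1) / B` minimises `φ(B s) - s u`; the minimum is minus the conjugate
function at `u / B`. -/
lemma exp_powerOrlicz_conjugate {α γ B u : ℝ} (hα : 1 < α) (hγ : 1 / α + 1 / γ = 1) (hB : 0 < B)
    (hu : 0 < u) : powerOrlicz α (B * ((u / B) ^ (γ - 1) / B)) - (u / B) ^ (γ - 1) / B * u =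
      -((u / B) ^ γ / γ) := by
  have hα0 : 0 < α := by linarith
  have h1 : (γ - 1) * α = γ ∧ γ ≠ 0 := by
    have hγ0 : γ ≠ 0 := by
      rintro rfl
      rw [div_zero, add_zero, div_eq_one_iff_eq hα0.ne'] at hγ
      linarith
    field_simp at hγ
    exact ⟨by linarith, hγ0⟩
  have hx : 0 < u / B := by positivity
  set x := u / B
  have h2 : B * (x ^ (γ - 1) / B) = x ^ (γ - 1) := by field_simp
  have h3 : x ^ (γ - 1) / B * u = x ^ γ := by
    rw [div_mul_eq_mul_div, mul_div_assoc, Real.rpow_sub_one hx.ne']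
    change x ^ γ / x * x = _
    field_simp
  rw [h2, h3, powerOrlicz, abs_of_pos (by positivity), ← Real.rpow_mul hx.le, h1.1]
  have h4 : 1 / α = 1 - 1 / γ := by linarith
  rw [div_eq_mul_one_div, h4]
  ring

theorem measure_sup_gt_le [IsProbabilityMeasure P] {α γ ρ : ℝ} (hα : 1 < α)
    (hγ : 1 / α + 1 / γ = 1) (hρ : 0 < ρ) {a b c d : ℝ} (hab : a ≤ b) (hcd : c ≤ d)
    {X : ℝ × ℝ → Ω → ℝ} (hX : ∀ p ∈ Icc a b ×ˢ Icc c d, AEMeasurable (X p) P)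
    (hcont : HasContinuousPathsOn (Icc a b ×ˢ Icc c d) X P) {C E : ℝ} (hC : 0 < C) (hE : 0 < E)
    (hXE : ∀ p ∈ Icc a b ×ˢ Icc c d, ExpMomentLE (powerOrlicz α) E (X p) P)
    (hinc : ∀ p ∈ Icc a b ×ˢ Icc c d, ∀ q ∈ Icc a b ×ˢ Icc c d, ∀ h : ℝ, 0 < h → dist p q ≤ h →
      ExpMomentLE (powerOrlicz α) (C * h ^ ρ) (fun ω => X p ω - X q ω) P)
    {θ : ℝ} (hθ0 : 0 < θ) (hθ1 : θ < 1) (hθ : θ * E < C * (max (b - a) (d - c) / 2) ^ ρ)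
    {u : ℝ} (hu : 0 < u) :
    P {ω | ∃ p ∈ Icc a b ×ˢ Icc c d, u < |X p ω|} ≤ ENNReal.ofReal
      (2 * Real.exp (-(u ^ γ * (1 - θ) ^ γ / (γ * E ^ γ))) * (Real.exp 1 * C) ^ (2 / ρ) *
        max (b - a) (d - c) ^ 2 * (θ * E) ^ (-(2 / ρ))) := by
  set D : Set (ℝ × ℝ) := Icc a b ×ˢ Icc c d
  set κ := max (b - a) (d - c)
  have h1θ : 0 < 1 - θ := by linarith
  have hκ0 : 0 ≤ κ := (sub_nonneg.2 hab).trans (le_max_left _ _)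
  -- Chosen so that `C h_k^ρ = θ^(k+1) E`, which is the standard required of the link from level `k
  -- + 1` to level `k`.
  let h : ℕ → ℝ := fun k => (θ ^ (k + 1) * E / C) ^ (1 / ρ)
  have hh : ∀ k, 0 < h k := fun k => by positivity
  have hhρ : ∀ k, C * h k ^ ρ = θ ^ (k + 1) * E := by
    intro k
    simp only [h]
    rw [← Real.rpow_mul (by positivity), one_div_mul_cancel hρ.ne', Real.rpow_one]
    field_simp
  have hanti : ∀ k, h k ≤ h 0 := by
    intro k
    refine Real.rpow_le_rpow (by positivity) ?_ (by positivity)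
    have : θ ^ (k + 1) ≤ θ ^ (0 + 1) := pow_le_pow_of_le_one hθ0.le hθ1.le (by omega)
    gcongr
  -- This is the role of the condition on `θ`: with `2 h_k ≤ κ`, the extra `1` in the size of a net
  -- is absorbed and the size is at most `(κ / h_k)²`.
  have hh0 : h 0 ≤ κ / 2 := by
    by_contra! hlt
    have h1 : (κ / 2) ^ ρ ≤ h 0 ^ ρ := Real.rpow_le_rpow (by positivity) hlt.le hρ.le
    have h2 := mul_le_mul_of_nonneg_left h1 hC.le
    rw [hhρ 0, zero_add, pow_one] at h2
    linarith
  have hκ : 0 < κ := by linarith [hh 0]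
  set x : ℝ := Real.log ((κ / h 0) ^ 2)
  have hx : 0 ≤ x := Real.log_nonneg (one_le_pow₀ ((one_le_div (hh 0)).2 (by linarith)))
  have hcard : ∀ k : ℕ, (κ / h k) ^ 2 = Real.exp (x + 2 / ρ * (k * -Real.log θ)) := by
    intro k
    have h1 : h k = h 0 * (θ ^ k) ^ (1 / ρ) := by
      simp only [h]
      rw [← Real.mul_rpow (by positivity) (by positivity)]
      congr 1
      ring
    have h2 : ((θ ^ k) ^ (1 / ρ)) ^ 2 = Real.exp (-(2 / ρ * (k * -Real.log θ))) := by
      rw [← Real.rpow_natCast θ, ← Real.rpow_mul hθ0.le, ← Real.rpow_natCast,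
        ← Real.rpow_mul hθ0.le, Real.rpow_def_of_pos hθ0]
      congr 1
      push_cast
      ring
    rw [Real.exp_add, Real.exp_log (by have := hh 0; positivity), h1, div_pow, mul_pow, h2,
      Real.exp_neg, div_pow]
    have := (hh 0).ne'
    field_simp
  have hnet : ∀ k : ℕ, ∃ V : Finset (ℝ × ℝ), (∀ p ∈ V, p ∈ D) ∧
      (V.card : ℝ) ≤ Real.exp (x + 2 / ρ * (k * -Real.log θ)) ∧
      ∀ p ∈ D, ∃ q ∈ V, dist p q ≤ h k := by
    intro k
    obtain ⟨V, h1, h2, h3⟩ := exists_net_rectangle hab hcd (hh k)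
    refine ⟨V, h1, h2.trans ?_, h3⟩
    rw [← hcard, sq]
    have h4 : ∀ z, 0 ≤ z → z ≤ κ → 0 ≤ z / (2 * h k) + 1 ∧ z / (2 * h k) + 1 ≤ κ / h k := by
      intro z hz hzκ
      have hk := hh k
      refine ⟨by positivity, ?_⟩
      rw [← sub_nonneg]
      have : κ / h k - (z / (2 * h k) + 1) = (2 * κ - z - 2 * h k) / (2 * h k) := by
        field_simp
        ring
      rw [this]
      refine div_nonneg ?_ (by positivity)
      linarith [hanti k]
    have h5 := h4 (b - a) (sub_nonneg.2 hab) (le_max_left _ _)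
    have h6 := h4 (d - c) (sub_nonneg.2 hcd) (le_max_right _ _)
    exact mul_le_mul h5.2 h6.2 h6.1 (h5.1.trans h5.2)
  choose V hVD hVc hVn using hnet
  have hproj : ∀ k p, ∃ q, p ∈ D → q ∈ V k ∧ dist p q ≤ h k := by
    intro k p
    by_cases hp : p ∈ D
    · obtain ⟨q, hq⟩ := hVn k p hp
      exact ⟨q, fun _ => hq⟩
    · exact ⟨p, fun hp' => absurd hp' hp⟩
  choose π hπ using hproj
  have hne : ∀ k, (V k).Nonempty := fun k => by
    obtain ⟨q, hq, -⟩ := hVn k (a, c) ⟨⟨le_rfl, hab⟩, le_rfl, hcd⟩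
    exact ⟨q, hq⟩
  set B := E / (1 - θ)
  have hB : 0 < B := by positivity
  set s := (u / B) ^ (γ - 1) / B
  have hs : 0 ≤ s := by positivity
  have hbound : ∀ K, P {ω | ∃ q ∈ V K, u < |X q ω|} ≤ ENNReal.ofReal
      (Real.exp (Real.log 2 + powerOrlicz α (B * s) + (x + 2 / ρ) - s * u)) := fun K =>
    measure_exists_gt_le_of_chain (by linarith) hE hθ0 hθ1 (fun k q hq => hX q (hVD k q hq)) hne
      (fun k q hq => (hπ k q (hVD _ q hq)).1) (fun q hq => hXE q (hVD 0 q hq))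
      (fun k q hq => by
        obtain ⟨h1, h2⟩ := hπ k q (hVD _ q hq)
        have := hinc q (hVD _ q hq) _ (hVD _ _ h1) (h k) (hh k) h2
        rwa [hhρ] at this) hx (by positivity) hVc hs u K
  have hlim : Tendsto h atTop (𝓝 0) := by
    have h1 : Tendsto (fun k : ℕ => θ ^ (k + 1) * E / C) atTop (𝓝 0) := by
      have := (((tendsto_pow_atTop_nhds_zero_of_lt_one hθ0.le hθ1).comp
        (tendsto_add_atTop_nat 1)).mul_const E).div_const C
      simpa using this
    have h2 := h1.rpow_const (p := 1 / ρ) (Or.inr (by positivity))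
    rwa [Real.zero_rpow (by positivity)] at h2
  -- The nets are not nested. By continuity an exceedance at some point of `D` is seen on all
  -- sufficiently fine nets, so a bound valid for every net carries over.
  have hsub : {ω | ∃ p ∈ D, u < |X p ω|} ≤ᵐ[P]
      {ω | ∀ᶠ K in atTop, ω ∈ {ω | ∃ q ∈ V K, u < |X q ω|}} := by
    filter_upwards [hcont] with ω hω
    rintro ⟨p, hp, hpu⟩
    obtain ⟨ε, hε, hnear⟩ := Metric.mem_nhdsWithin_iff.1
      ((hω.abs p hp).eventually (lt_mem_nhds hpu))
    refine (hlim.eventually (gt_mem_nhds hε)).mono fun K hK => ?_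
    obtain ⟨q, hq, hd⟩ := hVn K p hp
    refine ⟨q, hq, hnear ⟨?_, hVD K q hq⟩⟩
    rw [Metric.mem_ball, dist_comm]
    exact hd.trans_lt hK
  refine (measure_mono_ae hsub).trans ((measure_eventually_mem_le hbound).trans (le_of_eq ?_))
  congr 1
  have hsplit : Real.log 2 + powerOrlicz α (B * s) + (x + 2 / ρ) - s * u =
      Real.log 2 + (powerOrlicz α (B * s) - s * u) + x + 2 / ρ := by ring
  rw [hsplit, exp_powerOrlicz_conjugate hα hγ hB hu, Real.exp_add, Real.exp_add, Real.exp_add,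
    Real.exp_log (by norm_num), Real.exp_log (by have := hh 0; positivity)]
  have e1 : (u / B) ^ γ / γ = u ^ γ * (1 - θ) ^ γ / (γ * E ^ γ) := by
    have : u / B = u * (1 - θ) / E := by simp only [B]; field_simp
    rw [this, Real.div_rpow (by positivity) hE.le, Real.mul_rpow hu.le h1θ.le, div_div, mul_comm γ]
  have e2 : h 0 ^ 2 = (θ * E) ^ (2 / ρ) / C ^ (2 / ρ) := by
    simp only [h]
    rw [zero_add, pow_one, ← Real.rpow_natCast, ← Real.rpow_mul (by positivity),
      Real.div_rpow (by positivity) hC.le]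
    congr 2 <;> (push_cast; ring)
  rw [e1, div_pow, e2, Real.mul_rpow (Real.exp_pos _).le hC.le, ← Real.exp_mul, one_mul,
    Real.rpow_neg (by positivity)]
  have := (Real.rpow_pos_of_pos hC (2 / ρ)).ne'
  have := (Real.rpow_pos_of_pos (mul_pos hθ0 hE) (2 / ρ)).ne'
  field_simp

end Chaining

/-! ### Estimates for the kernel and the Hölder weight -/

section Kernel

lemma continuous_dispersionPoly (N : ℕ) (coef : ℕ → ℝ) : Continuous (dispersionPoly N coef) := by
  unfold dispersionPoly
  fun_prop

lemma continuous_solutionKernel {κ : ℝ → ℝ} (hκ : κ = Real.cos ∨ κ = Real.sin) (N : ℕ)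
    (coef : ℕ → ℝ) (t x : ℝ) : Continuous (solutionKernel κ N coef t x) := by
  have h : Continuous fun l => l * x + t * dispersionPoly N coef l :=
    (continuous_mul_const x).add (continuous_const.mul (continuous_dispersionPoly N coef))
  rcases hκ with rfl | rfl
  · exact Real.continuous_cos.comp h
  · exact Real.continuous_sin.comp h

lemma abs_solutionKernel_le_one {κ : ℝ → ℝ} (hκ : κ = Real.cos ∨ κ = Real.sin) (N : ℕ)
    (coef : ℕ → ℝ) (t x l : ℝ) : |solutionKernel κ N coef t x l| ≤ 1 := by
  rcases hκ with rfl | rfl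
  · exact Real.abs_cos_le_one _
  · exact Real.abs_sin_le_one _

lemma abs_sin_le_rpow {ρ : ℝ} (hρ0 : 0 < ρ) (hρ1 : ρ ≤ 1) (z : ℝ) : |Real.sin z| ≤ |z| ^ ρ := by
  rcases le_total |z| 1 with h | h
  · exact Real.abs_sin_le_abs.trans (Real.self_le_rpow_of_le_one (abs_nonneg z) h hρ1)
  · exact (Real.abs_sin_le_one z).trans (Real.one_le_rpow h hρ0.le)

lemma abs_sub_le_two_mul_abs_sin {κ : ℝ → ℝ} (hκ : κ = Real.cos ∨ κ = Real.sin) (u v : ℝ) :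
    |κ u - κ v| ≤ 2 * |Real.sin ((u - v) / 2)| := by
  rcases hκ with rfl | rfl
  · rw [Real.cos_sub_cos, abs_mul, abs_mul]
    have := mul_le_mul_of_nonneg_right (Real.abs_sin_le_one ((u + v) / 2))
      (abs_nonneg (Real.sin ((u - v) / 2)))
    norm_num
    linarith
  · rw [Real.sin_sub_sin, abs_mul, abs_mul]
    have := mul_le_mul_of_nonneg_left (Real.abs_cos_le_one ((u + v) / 2))
      (abs_nonneg (Real.sin ((u - v) / 2)))
    norm_num
    linarith

lemma abs_sin_add_le (u v : ℝ) : |Real.sin (u + v)| ≤ |Real.sin u| + |Real.sin v| := by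
  rw [Real.sin_add]
  refine (abs_add_le _ _).trans ?_
  rw [abs_mul, abs_mul]
  have h1 := mul_le_mul_of_nonneg_left (Real.abs_cos_le_one v) (abs_nonneg (Real.sin u))
  have h2 := mul_le_mul_of_nonneg_right (Real.abs_cos_le_one u) (abs_nonneg (Real.sin v))
  linarith

lemma continuous_holderWeight (N : ℕ) (coef : ℕ → ℝ) {ρ : ℝ} (hρ : 0 < ρ) :
    Continuous (holderWeight N coef ρ) :=
  ((continuous_abs.div_const 2).rpow_const fun _ => Or.inr hρ.le).add
    ((continuous_const.mul (continuous_dispersionPoly N coef)).abs.rpow_const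
      fun _ => Or.inr hρ.le)

/-- The difference of cosines or sines is at most `2 |sin|` of half the phase difference.
Subadditivity of `|sin|` separates the `x` and `t` parts, and `|sin z| ≤ |z|^ρ` is applied to each.
-/
lemma abs_solutionKernel_sub_le {κ : ℝ → ℝ} (hκ : κ = Real.cos ∨ κ = Real.sin) (N : ℕ)
    (coef : ℕ → ℝ) {ρ : ℝ} (hρ0 : 0 < ρ) (hρ1 : ρ ≤ 1) {h t t₁ x x₁ : ℝ}
    (ht : |t - t₁| ≤ h) (hx : |x - x₁| ≤ h) (l : ℝ) :
    |solutionKernel κ N coef t x l - solutionKernel κ N coef t₁ x₁ l| ≤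
      2 * h ^ ρ * holderWeight N coef ρ l := by
  have key : ∀ z w : ℝ, |z| ≤ h → |Real.sin (z * w)| ≤ h ^ ρ * |w| ^ ρ := by
    intro z w hz
    refine (abs_sin_le_rpow hρ0 hρ1 _).trans ?_
    rw [abs_mul, Real.mul_rpow (abs_nonneg _) (abs_nonneg _)]
    gcongr
  refine (abs_sub_le_two_mul_abs_sin hκ _ _).trans ?_
  have h1 : (l * x + t * dispersionPoly N coef l - (l * x₁ + t₁ * dispersionPoly N coef l)) / 2 =
      (x - x₁) * (l / 2) + (t - t₁) * (1 / 2 * dispersionPoly N coef l) := by ring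
  rw [h1]
  have h2 := abs_sin_add_le ((x - x₁) * (l / 2)) ((t - t₁) * (1 / 2 * dispersionPoly N coef l))
  have h3 := key (x - x₁) (l / 2) hx
  have h4 := key (t - t₁) (1 / 2 * dispersionPoly N coef l) ht
  rw [abs_div, abs_two] at h3
  unfold holderWeight
  linarith

/-- The moment weight vanishes at the origin and cannot dominate the Hölder weight there, hence the
two regimes `|l| ≤ 1` and `|l| ≥ 1`. -/
lemma exists_holderWeight_le (N : ℕ) (coef : ℕ → ℝ) {ρ : ℝ} (hρ : 0 < ρ) :
    ∃ C : ℝ, 0 ≤ C ∧ (∀ l, |l| ≤ 1 → holderWeight N coef ρ l ≤ C) ∧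
      ∀ l, 1 ≤ |l| → holderWeight N coef ρ l ≤ C * |l| ^ ((2 * (N : ℝ) + 1) * (ρ + 1)) := by
  set A : ℝ := ∑ k ∈ Finset.Icc 1 N, |coef k|
  have hA : 0 ≤ A := Finset.sum_nonneg fun _ _ => abs_nonneg _
  have hpoly : ∀ l m : ℝ, |l| ≤ m → 1 ≤ m → |dispersionPoly N coef l| ≤ A * m ^ (2 * N + 1) := by
    intro l m hl hm
    unfold dispersionPoly
    refine (Finset.abs_sum_le_sum_abs _ _).trans ?_
    rw [Finset.sum_mul]
    refine Finset.sum_le_sum fun k hk => ?_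
    rw [abs_mul, abs_mul, abs_pow, abs_pow, abs_neg, abs_one, one_pow, mul_one]
    refine mul_le_mul_of_nonneg_left ?_ (abs_nonneg _)
    refine (pow_le_pow_left₀ (abs_nonneg l) hl _).trans (pow_le_pow_right₀ hm ?_)
    have := (Finset.mem_Icc.1 hk).2
    omega
  have hq : ρ ≤ (2 * (N : ℝ) + 1) * (ρ + 1) := by
    have : 0 ≤ (N : ℝ) := Nat.cast_nonneg N
    nlinarith
  have hq' : (2 * (N : ℝ) + 1) * ρ ≤ (2 * (N : ℝ) + 1) * (ρ + 1) := by
    have : 0 ≤ (N : ℝ) := Nat.cast_nonneg N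
    nlinarith
  have hw : ∀ l m : ℝ, |l| ≤ m → 1 ≤ m →
      holderWeight N coef ρ l ≤ (1 + A ^ ρ) * m ^ ((2 * (N : ℝ) + 1) * (ρ + 1)) := by
    intro l m hl hm
    have hm0 : 0 < m := by linarith
    have h1 : (|l| / 2) ^ ρ ≤ m ^ ((2 * (N : ℝ) + 1) * (ρ + 1)) :=
      (Real.rpow_le_rpow (by positivity) (by linarith [abs_nonneg l]) hρ.le).trans
        (Real.rpow_le_rpow_of_exponent_le hm hq)
    have h2 : |1 / 2 * dispersionPoly N coef l| ≤ A * m ^ (2 * N + 1) := by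
      rw [abs_mul, abs_of_pos (by norm_num : (0 : ℝ) < 1 / 2)]
      linarith [hpoly l m hl hm, abs_nonneg (dispersionPoly N coef l)]
    have h3 : |1 / 2 * dispersionPoly N coef l| ^ ρ ≤
        A ^ ρ * m ^ ((2 * (N : ℝ) + 1) * (ρ + 1)) := by
      refine (Real.rpow_le_rpow (abs_nonneg _) h2 hρ.le).trans ?_
      rw [Real.mul_rpow hA (by positivity), ← Real.rpow_natCast, ← Real.rpow_mul hm0.le]
      push_cast
      exact mul_le_mul_of_nonneg_left (Real.rpow_le_rpow_of_exponent_le hm hq')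
        (Real.rpow_nonneg hA _)
    unfold holderWeight
    linarith
  refine ⟨1 + A ^ ρ, by positivity, fun l hl => ?_, fun l hl => hw l |l| le_rfl hl⟩
  simpa using hw l 1 hl le_rfl

end Kernel

/-! ### Centered Gaussian processes are strictly sub-Gaussian with constant one -/

section Gaussian

variable {Ω : Type*} [MeasurableSpace Ω] {P : Measure Ω}

lemma eLpNorm_two_eq_ofReal_sqrt {ζ : Ω → ℝ} (h : MemLp ζ 2 P) :
    eLpNorm ζ 2 P = ENNReal.ofReal √(∫ ω, ζ ω ^ 2 ∂P) := by
  rw [h.eLpNorm_eq_integral_rpow_norm (by norm_num) (by norm_num), Real.sqrt_eq_rpow]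
  simp

lemma ProbabilityTheory.HasGaussianLaw.expMomentLE [IsProbabilityMeasure P] {ζ : Ω → ℝ}
    (h : HasGaussianLaw ζ P) (h0 : ∫ ω, ζ ω ∂P = 0) :
    ExpMomentLE (powerOrlicz 2) √(∫ ω, ζ ω ^ 2 ∂P) ζ P := by
  intro l
  have h1 := mgf_gaussianReal h.map_eq_gaussianReal l
  have hv : Var[ζ; P] = ∫ ω, ζ ω ^ 2 ∂P := variance_of_integral_eq_zero h.aemeasurable h0
  rw [h0, zero_mul, zero_add, Real.coe_toNNReal _ (variance_nonneg _ _), hv] at h1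
  have hint : Integrable (fun ω => Real.exp (l * ζ ω)) P := by
    by_contra hn
    rw [mgf, integral_undef hn] at h1
    exact (Real.exp_pos _).ne h1
  rw [← ofReal_integral_eq_lintegral_ofReal hint (Eventually.of_forall fun _ => (Real.exp_pos _).le)]
  refine ENNReal.ofReal_le_ofReal (le_of_eq ?_)
  have hs : 0 ≤ ∫ ω, ζ ω ^ 2 ∂P := integral_nonneg fun _ => sq_nonneg _
  rw [mgf] at h1
  rw [h1, powerOrlicz, Real.rpow_two, sq_abs, mul_pow, Real.sq_sqrt hs]

lemma ProbabilityTheory.IsGaussianProcess.isStrictlyPhiSubGaussian [IsProbabilityMeasure P]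
    {y : ℝ → Ω → ℝ} (h : IsGaussianProcess y P) (h0 : ∀ s, ∫ ω, y s ω ∂P = 0) :
    IsStrictlyPhiSubGaussian (powerOrlicz 2) y 1 P := by
  constructor
  · intro u
    have h1 := (h.hasGaussianLaw_eval u).expMomentLE (h0 u)
    refine ⟨h.aemeasurable u, h0 u, max √(∫ ω, y u ω ^ 2 ∂P) 1, lt_max_of_lt_right one_pos, fun l => ?_⟩
    rw [mul_comm l]
    exact h1.mono two_pos (Real.sqrt_nonneg _) (le_max_left _ 1) l
  · intro s c
    have hg : HasGaussianLaw (fun ω => ∑ u ∈ s, c u * y u ω) P :=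
      (h.smul c).hasGaussianLaw_fun_sum
    rw [ENNReal.coe_one, one_mul, eLpNorm_two_eq_ofReal_sqrt hg.memLp_two,
      subGaussianStandard_le_ofReal_iff two_pos (Real.sqrt_nonneg _)]
    refine hg.expMomentLE ?_
    rw [integral_finsetSum _ fun u _ => ((h.hasGaussianLaw_eval u).integrable).const_mul _]
    exact Finset.sum_eq_zero fun u _ => by rw [integral_const_mul, h0, mul_zero]

end Gaussian

/-! ### The random field `U` -/

section SolutionField

variable {Ω : Type*} [MeasurableSpace Ω] {P : Measure Ω}

lemma IsMeanSquareIntegral.sub {y : ℝ → Ω → ℝ} (hy : ∀ s, MemLp (y s) 2 P) {f f' : ℝ → ℝ}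
    {J J' : Ω → ℝ} (h : IsMeanSquareIntegral f y J P) (h' : IsMeanSquareIntegral f' y J' P) :
    IsMeanSquareIntegral (fun l => f l - f' l) y (fun ω => J ω - J' ω) P := by
  obtain ⟨hJ, h⟩ := (isMeanSquareIntegral_iff hy).1 h
  obtain ⟨hJ', h'⟩ := (isMeanSquareIntegral_iff hy).1 h'
  exact (isMeanSquareIntegral_iff hy).2 ⟨hJ.sub hJ', h.sub h'⟩

/-- The single source of the estimates on `U`. It is used with `M = 0` for the bound by `C_Z`, with
`g = 0` for `ε₀ < ∞`, and with both parts for the finite Hölder constant. -/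
lemma IsMeanSquareIntegral.expMomentLE {α : ℝ} (hα : 0 < α) {y : ℝ → Ω → ℝ} {Cy : ℝ≥0}
    (hs : IsStrictlyPhiSubGaussian (powerOrlicz α) y Cy P) (hy : ∀ s, MemLp (y s) 2 P) {V : ℝ}
    (hV : GridVariationLE (covFun y P) V) {f f₁ f₂ g : ℝ → ℝ} (hg : Continuous g) {W : ℝ}
    (hW0 : 0 ≤ W) (hW : variationIntegral (covFun y P) (fun l m => ENNReal.ofReal (g l * g m))
      ≤ ENNReal.ofReal W) {M c : ℝ} (hM : 0 ≤ M) (hc : 0 ≤ c) (hf : ∀ x, f x = f₁ x + f₂ x)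
    (hf₁ : ∀ x, |f₁ x| ≤ M) (hf₂ : ∀ x, |f₂ x| ≤ c * g x) {J : Ω → ℝ}
    (hJ : IsMeanSquareIntegral f y J P) :
    ExpMomentLE (powerOrlicz α) (Cy * (M * √V + c * √W)) J P := by
  obtain ⟨hJm, hJ⟩ := (isMeanSquareIntegral_iff hy).1 hJ
  rw [← gramKernel_toL2 hy] at hV hW
  have h1 := hs.expMomentLE_of_mem_closure hα hy hJ.mem_closure_span
  have h2 := hJ.norm_le hV hg hW0 hW hM hc hf hf₁ hf₂
  refine (h1.congr hJm.coeFn_toLp).mono hα (by positivity) ?_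
  exact mul_le_mul_of_nonneg_left h2 Cy.2

lemma variationIntegral_zero (Γ : ℝ → ℝ → ℝ) :
    variationIntegral Γ (fun _ _ => ENNReal.ofReal (0 * 0)) ≤ ENNReal.ofReal 0 := by
  unfold variationIntegral
  simp only [mul_zero, ENNReal.ofReal_zero, nonpos_iff_eq_zero, ENNReal.iSup_eq_zero]
  intro n m s t hs ht
  refine Finset.sum_eq_zero fun i _ => Finset.sum_eq_zero fun j _ => ?_
  -- Monotonicity of the grids makes the cells nonempty; an infimum over an empty cell would be `∞`.
  have : (⨅ (u ∈ Icc (s i) (s (i + 1))) (v ∈ Icc (t j) (t (j + 1))), (0 : ℝ≥0∞)) = 0 := by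
    refine le_antisymm ?_ zero_le
    exact (iInf₂_le _ (left_mem_Icc.2 (hs (Nat.le_succ i)))).trans
      (iInf₂_le _ (left_mem_Icc.2 (ht (Nat.le_succ j))))
  rw [this, zero_mul]

lemma exists_isMeanSquareIntegral {y : ℝ → Ω → ℝ} (hy : ∀ s, MemLp (y s) 2 P)
    (hvar : HasFiniteVitaliVariation (covFun y P)) {f : ℝ → ℝ} (hf : Continuous f)
    (hf1 : ∀ x, |f x| ≤ 1) {q : ℝ} (hq : 0 < q)
    (hint : variationIntegral (covFun y P) (fun l m => ENNReal.ofReal (|l| ^ q * |m| ^ q)) < ∞) :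
    ∃ J, IsMeanSquareIntegral f y J P := by
  obtain ⟨V, -, hV⟩ := hvar.exists_gridVariationLE
  rw [← gramKernel_toL2 hy] at hV hint
  obtain ⟨J, hJ⟩ := exists_isStieltjesIntegral hV hf hf1 hq ENNReal.toReal_nonneg
    (ENNReal.ofReal_toReal hint.ne).ge
  exact ⟨J, (isMeanSquareIntegral_iff hy).2 ⟨Lp.memLp J, by rwa [Lp.toLp_coeFn]⟩⟩

variable {N : ℕ} {coef : ℕ → ℝ} {κ : ℝ → ℝ} {ρ : ℝ} {y : ℝ → Ω → ℝ} {α : ℝ} {Cy : ℝ≥0}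
  {D : Set (ℝ × ℝ)} {U : ℝ × ℝ → Ω → ℝ}

lemma IsSolutionField.expMomentLE_sub (hκ : κ = Real.cos ∨ κ = Real.sin) (hρ0 : 0 < ρ)
    (hρ1 : ρ ≤ 1) (hvar : HasFiniteVitaliVariation (covFun y P)) (hα : 0 < α)
    (hs : IsStrictlyPhiSubGaussian (powerOrlicz α) y Cy P) (hy : ∀ s, MemLp (y s) 2 P)
    (hCZ : constCZ (covFun y P) N coef ρ ≠ ∞) (hU : IsSolutionField κ N coef y D U P)
    {p q : ℝ × ℝ} (hp : p ∈ D) (hq : q ∈ D) {h : ℝ} (hh : 0 < h) (hpq : dist p q ≤ h) :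
    ExpMomentLE (powerOrlicz α) (2 * (constCZ (covFun y P) N coef ρ).toReal * Cy * h ^ ρ)
      (fun ω => U p ω - U q ω) P := by
  obtain ⟨V, -, hV⟩ := hvar.exists_gridVariationLE
  rw [constCZ] at hCZ ⊢
  set W := variationIntegral (covFun y P) fun l m =>
    ENNReal.ofReal (holderWeight N coef ρ l * holderWeight N coef ρ m)
  have hW : W ≠ ∞ := fun h => hCZ (by rw [h, ENNReal.top_rpow_of_pos (by norm_num)])
  have h1 := (IsMeanSquareIntegral.sub hy (hU p hp) (hU q hq)).expMomentLE hα hs hy hV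
    (continuous_holderWeight N coef hρ0) ENNReal.toReal_nonneg (ENNReal.ofReal_toReal hW).ge
    (M := 0) (c := 2 * h ^ ρ) le_rfl (by positivity) (f₁ := fun _ => 0)
    (f₂ := fun l => solutionKernel κ N coef p.1 p.2 l - solutionKernel κ N coef q.1 q.2 l)
    (fun x => by simp) (fun x => by simp)
    (abs_solutionKernel_sub_le hκ N coef hρ0 hρ1 ((le_max_left _ _).trans hpq)
      ((le_max_right _ _).trans hpq))
  rw [← ENNReal.toReal_rpow, ← Real.sqrt_eq_rpow]
  convert! h1 using 1
  ring

/-- The increment of the kernel is cut at `|l| = 1`: the inner part is bounded and paid for by the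
total variation, the outer part by the moment hypothesis. No integral over the mixed region `|l| ≤ 1
< |m|` is needed, so the constant is finite regardless of `C_Z`. -/
lemma exists_expMomentLE_sub (hκ : κ = Real.cos ∨ κ = Real.sin) (hρ0 : 0 < ρ) (hρ1 : ρ ≤ 1)
    (hvar : HasFiniteVitaliVariation (covFun y P))
    (hint : variationIntegral (covFun y P) (fun l m =>
      ENNReal.ofReal (|l| ^ ((2 * (N : ℝ) + 1) * (ρ + 1)) *
        |m| ^ ((2 * (N : ℝ) + 1) * (ρ + 1)))) < ∞) (hα : 0 < α)
    (hs : IsStrictlyPhiSubGaussian (powerOrlicz α) y Cy P) (hy : ∀ s, MemLp (y s) 2 P) :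
    ∃ K : ℝ, 0 ≤ K ∧ ∀ U : ℝ × ℝ → Ω → ℝ, IsSolutionField κ N coef y D U P →
      ∀ p ∈ D, ∀ q ∈ D, ∀ h : ℝ, 0 < h → dist p q ≤ h →
        ExpMomentLE (powerOrlicz α) (Cy * (K * h ^ ρ)) (fun ω => U p ω - U q ω) P := by
  obtain ⟨V, -, hV⟩ := hvar.exists_gridVariationLE
  obtain ⟨C, hC, hC1, hC2⟩ := exists_holderWeight_le N coef hρ0
  have hq0 : 0 < (2 * (N : ℝ) + 1) * (ρ + 1) := by positivity
  set r := (2 * (N : ℝ) + 1) * (ρ + 1)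
  set W := variationIntegral (covFun y P) fun l m => ENNReal.ofReal (|l| ^ r * |m| ^ r)
  refine ⟨2 * C * √V + 2 * C * √W.toReal, by positivity, fun U hU p hp q hq h hh hpq => ?_⟩
  let f : ℝ → ℝ := fun l =>
    solutionKernel κ N coef p.1 p.2 l - solutionKernel κ N coef q.1 q.2 l
  have hf : ∀ l, |f l| ≤ 2 * h ^ ρ * holderWeight N coef ρ l :=
    abs_solutionKernel_sub_le hκ N coef hρ0 hρ1 ((le_max_left _ _).trans hpq)
      ((le_max_right _ _).trans hpq)
  have h1 := (IsMeanSquareIntegral.sub hy (hU p hp) (hU q hq)).expMomentLE hα hs hy hV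
    (g := fun l => |l| ^ r) (continuous_abs.rpow_const fun _ => Or.inr hq0.le)
    ENNReal.toReal_nonneg (ENNReal.ofReal_toReal hint.ne).ge
    (M := 2 * h ^ ρ * C) (c := 2 * h ^ ρ * C) (by positivity) (by positivity)
    (f₁ := fun l => if |l| ≤ 1 then f l else 0) (f₂ := fun l => if |l| ≤ 1 then 0 else f l)
    (fun x => by split_ifs <;> simp [f]) (fun x => ?_) (fun x => ?_)
  · convert! h1 using 1
    ring
  · split_ifs with hx
    · exact (hf x).trans (mul_le_mul_of_nonneg_left (hC1 x hx) (by positivity))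
    · rw [abs_zero]; positivity
  · split_ifs with hx
    · rw [abs_zero]; positivity
    · rw [mul_assoc]
      exact (hf x).trans (mul_le_mul_of_nonneg_left (hC2 x (not_le.1 hx).le) (by positivity))

lemma IsSolutionField.supStandard_lt_top (hκ : κ = Real.cos ∨ κ = Real.sin)
    (hvar : HasFiniteVitaliVariation (covFun y P)) (hα : 0 < α)
    (hs : IsStrictlyPhiSubGaussian (powerOrlicz α) y Cy P) (hy : ∀ s, MemLp (y s) 2 P)
    (hU : IsSolutionField κ N coef y D U P) : supStandard (powerOrlicz α) D U P < ∞ := by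
  obtain ⟨V, -, hV⟩ := hvar.exists_gridVariationLE
  refine lt_of_le_of_lt (iSup₂_le fun p hp => ?_)
    (ENNReal.ofReal_lt_top (r := Cy * (1 * √V + 0 * √0)))
  rw [subGaussianStandard_le_ofReal_iff hα (by positivity)]
  exact (hU p hp).expMomentLE hα hs hy hV (g := fun _ => 0) continuous_const le_rfl
    (variationIntegral_zero _) zero_le_one le_rfl (f₂ := fun _ => 0) (fun x => by simp)
    (abs_solutionKernel_le_one hκ N coef p.1 p.2) (fun x => by simp)

lemma exists_continuous_solutionField (hκ : κ = Real.cos ∨ κ = Real.sin) (hρ0 : 0 < ρ)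
    (hρ1 : ρ ≤ 1) (hvar : HasFiniteVitaliVariation (covFun y P))
    (hint : variationIntegral (covFun y P) (fun l m =>
      ENNReal.ofReal (|l| ^ ((2 * (N : ℝ) + 1) * (ρ + 1)) *
        |m| ^ ((2 * (N : ℝ) + 1) * (ρ + 1)))) < ∞) (hα : 0 < α)
    (hs : IsStrictlyPhiSubGaussian (powerOrlicz α) y Cy P) (hy : ∀ s, MemLp (y s) 2 P)
    {a b c d : ℝ} (hab : a ≤ b) (hcd : c ≤ d) :
    ∃ U : ℝ × ℝ → Ω → ℝ, IsSolutionField κ N coef y (Icc a b ×ˢ Icc c d) U P ∧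
      HasContinuousPathsOn (Icc a b ×ˢ Icc c d) U P := by
  have hex : ∀ p : ℝ × ℝ, ∃ J, IsMeanSquareIntegral (solutionKernel κ N coef p.1 p.2) y J P :=
    fun p => exists_isMeanSquareIntegral hy hvar (continuous_solutionKernel hκ N coef p.1 p.2)
      (abs_solutionKernel_le_one hκ N coef p.1 p.2) (by positivity) hint
  choose X hX using hex
  obtain ⟨K, hK0, hK⟩ := exists_expMomentLE_sub (D := Icc a b ×ˢ Icc c d) (coef := coef) hκ hρ0
    hρ1 hvar hint hα hs hy
  obtain ⟨U, hU1, hU2⟩ := exists_continuous_modification (α := α) hρ0 hab hcd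
    -- The summand `1` only makes the constant positive, as the modification lemma requires.
    (fun p => (hX p).1.aestronglyMeasurable.aemeasurable) (K := Cy * K + 1) (by positivity)
    fun p hp q hq h hh hpq => (hK X (fun p _ => hX p) p hp q hq h hh hpq).mono hα (by positivity)
      (by rw [← mul_assoc]; gcongr; linarith)
  exact ⟨U, fun p hp => (hX p).congr (hU1 p hp), hU2⟩

lemma IsSolutionField.subGaussianStandard_sub_le (hκ : κ = Real.cos ∨ κ = Real.sin) (hρ0 : 0 < ρ)
    (hρ1 : ρ ≤ 1) (hvar : HasFiniteVitaliVariation (covFun y P))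
    (hint : variationIntegral (covFun y P) (fun l m =>
      ENNReal.ofReal (|l| ^ ((2 * (N : ℝ) + 1) * (ρ + 1)) *
        |m| ^ ((2 * (N : ℝ) + 1) * (ρ + 1)))) < ∞) (hα : 0 < α)
    (hs : IsStrictlyPhiSubGaussian (powerOrlicz α) y Cy P) (hy : ∀ s, MemLp (y s) 2 P)
    (hU : IsSolutionField κ N coef y D U P) {p q : ℝ × ℝ} (hp : p ∈ D) (hq : q ∈ D) {h : ℝ}
    (hh : 0 < h) (hpq : dist p q ≤ h) :
    subGaussianStandard (powerOrlicz α) (fun ω => U p ω - U q ω) P ≤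
      2 * constCZ (covFun y P) N coef ρ * Cy * ENNReal.ofReal (h ^ ρ) := by
  rcases eq_or_ne (constCZ (covFun y P) N coef ρ) ∞ with hCZ | hCZ
  -- With `C_Z = ∞` and `C_y = 0` the right-hand side is `∞ · 0 = 0`, so the claim is not vacuous;
  -- the bound with a finite constant shows that the increment has standard `0`.
  · rcases eq_or_ne Cy 0 with hCy | hCy
    · obtain ⟨K, -, hK⟩ := exists_expMomentLE_sub (D := D) (coef := coef) hκ hρ0 hρ1 hvar hint hα
        hs hy
      have h1 := hK U hU p hp q hq h hh hpq
      rw [hCy, NNReal.coe_zero, zero_mul, ← subGaussianStandard_le_ofReal_iff hα le_rfl,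
        ENNReal.ofReal_zero] at h1
      exact h1.trans zero_le
    · have h2 : ENNReal.ofReal (h ^ ρ) ≠ 0 := (ENNReal.ofReal_pos.2 (by positivity)).ne'
      rw [hCZ, ENNReal.mul_top (by norm_num), ENNReal.top_mul (by simpa using hCy),
        ENNReal.top_mul h2]
      exact le_top
  · have h1 := hU.expMomentLE_sub hκ hρ0 hρ1 hvar hα hs hy hCZ hp hq hh hpq
    rw [← subGaussianStandard_le_ofReal_iff hα (by positivity)] at h1
    refine h1.trans (le_of_eq ?_)
    rw [ENNReal.ofReal_mul (by positivity), ENNReal.ofReal_mul (by positivity),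
      ENNReal.ofReal_mul (by norm_num), ENNReal.ofReal_toReal hCZ, ENNReal.ofReal_coe_nnreal,
      ENNReal.ofReal_ofNat]

lemma IsSolutionField.measure_sup_gt_le [IsProbabilityMeasure P]
    (hκ : κ = Real.cos ∨ κ = Real.sin) (hρ0 : 0 < ρ)
    (hρ1 : ρ ≤ 1) (hvar : HasFiniteVitaliVariation (covFun y P)) (hα : 1 < α)
    (hs : IsStrictlyPhiSubGaussian (powerOrlicz α) y Cy P) (hy : ∀ s, MemLp (y s) 2 P)
    {a b c d : ℝ} (hab : a ≤ b) (hcd : c ≤ d)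
    (hU : IsSolutionField κ N coef y (Icc a b ×ˢ Icc c d) U P)
    (hcont : HasContinuousPathsOn (Icc a b ×ˢ Icc c d) U P) {θ : ℝ} (hθ0 : 0 < θ) (hθ1 : θ < 1)
    (hθ : ENNReal.ofReal θ * supStandard (powerOrlicz α) (Icc a b ×ˢ Icc c d) U P
      < 2 * constCZ (covFun y P) N coef ρ * Cy * ENNReal.ofReal (max (b - a) (d - c) / 2) ^ ρ)
    {γ : ℝ} (hγ : 1 / α + 1 / γ = 1) {u : ℝ} (hu : 0 < u) :
    P {ω | ENNReal.ofReal u < ⨆ p ∈ Icc a b ×ˢ Icc c d, ENNReal.ofReal |U p ω|}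
      ≤ 2 * ENNReal.ofReal (Real.exp (-(u ^ γ * (1 - θ) ^ γ /
          (γ * (supStandard (powerOrlicz α) (Icc a b ×ˢ Icc c d) U P).toReal ^ γ)))) *
        (2 * ENNReal.ofReal (Real.exp 1) * constCZ (covFun y P) N coef ρ * Cy) ^ (2 / ρ) *
        ENNReal.ofReal (max (b - a) (d - c)) ^ 2 *
        (ENNReal.ofReal θ * supStandard (powerOrlicz α) (Icc a b ×ˢ Icc c d) U P)
          ^ (-(2 / ρ)) := by
  have hα0 : 0 < α := by linarith
  have hfin := hU.supStandard_lt_top hκ hvar hα0 hs hy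
  have hinc := fun (hCZ : constCZ (covFun y P) N coef ρ ≠ ∞) p
    (hp : p ∈ Icc a b ×ˢ Icc c d) q (hq : q ∈ Icc a b ×ˢ Icc c d) (h : ℝ) (hh : 0 < h)
    (hpq : dist p q ≤ h) => hU.expMomentLE_sub hκ hρ0 hρ1 hvar hα0 hs hy hCZ hp hq hh hpq
  have hS : ∀ p ∈ Icc a b ×ˢ Icc c d, subGaussianStandard (powerOrlicz α) (U p) P ≤
      supStandard (powerOrlicz α) (Icc a b ×ˢ Icc c d) U P := fun p hp =>
    le_iSup₂ (f := fun p (_ : p ∈ Icc a b ×ˢ Icc c d) =>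
      subGaussianStandard (powerOrlicz α) (U p) P) p hp
  have hset : {ω | ENNReal.ofReal u < ⨆ p ∈ Icc a b ×ˢ Icc c d, ENNReal.ofReal |U p ω|} =
      {ω | ∃ p ∈ Icc a b ×ˢ Icc c d, u < |U p ω|} := by
    ext ω
    change ENNReal.ofReal u < _ ↔ ∃ p ∈ Icc a b ×ˢ Icc c d, u < |U p ω|
    simp only [lt_iSup_iff, exists_prop, ENNReal.ofReal_lt_ofReal_iff_of_nonneg hu.le]
  rw [hset]
  set S := supStandard (powerOrlicz α) (Icc a b ×ˢ Icc c d) U P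
  set Z := constCZ (covFun y P) N coef ρ
  set x := max (b - a) (d - c)
  -- The strict inequality on `θ` forces `C_Z`, `C_y` and the side length to be nonzero. This rules
  -- out products `0 · ∞`, so for `ε₀ = 0` or `C_Z = ∞` the right-hand side is `∞`; otherwise all
  -- quantities are real and positive.
  have hne := (zero_le.trans_lt hθ).ne'
  have hxpow := right_ne_zero_of_mul hne
  have hCy := right_ne_zero_of_mul (left_ne_zero_of_mul hne)
  have hZ := right_ne_zero_of_mul (left_ne_zero_of_mul (left_ne_zero_of_mul hne))
  have hx : 0 < x := by
    by_contra! h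
    exact hxpow (by rw [ENNReal.ofReal_of_nonpos (by linarith), ENNReal.zero_rpow_of_pos hρ0])
  have hρ2 : 0 < 2 / ρ := by positivity
  have hexp : 2 * ENNReal.ofReal (Real.exp (-(u ^ γ * (1 - θ) ^ γ / (γ * S.toReal ^ γ)))) ≠ 0 :=
    mul_ne_zero two_ne_zero (ENNReal.ofReal_pos.2 (Real.exp_pos _)).ne'
  have hxsq : ENNReal.ofReal x ^ 2 ≠ 0 := pow_ne_zero _ (ENNReal.ofReal_pos.2 hx).ne'
  have he : 2 * ENNReal.ofReal (Real.exp 1) ≠ 0 :=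
    mul_ne_zero two_ne_zero (ENNReal.ofReal_pos.2 (Real.exp_pos _)).ne'
  have hθne : ENNReal.ofReal θ ≠ 0 := (ENNReal.ofReal_pos.2 hθ0).ne'
  have hbase : (2 * ENNReal.ofReal (Real.exp 1) * Z * Cy) ^ (2 / ρ) ≠ 0 := by
    rw [Ne, ENNReal.rpow_eq_zero_iff_of_pos hρ2]
    exact mul_ne_zero (mul_ne_zero he hZ) hCy
  rcases eq_or_ne S 0 with hS0 | hS0
  · rw [hS0, mul_zero, ENNReal.zero_rpow_of_neg (by linarith), ENNReal.mul_top]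
    · exact le_top
    · rw [hS0] at hexp
      exact mul_ne_zero (mul_ne_zero hexp hbase) hxsq
  rcases eq_or_ne Z ∞ with hZt | hZt
  · rw [hZt, ENNReal.mul_top he, ENNReal.top_mul hCy, ENNReal.top_rpow_of_pos hρ2,
      ENNReal.mul_top hexp, ENNReal.top_mul hxsq, ENNReal.top_mul]
    · exact le_top
    · rw [Ne, ENNReal.rpow_eq_zero_iff]
      rintro (⟨-, h⟩ | ⟨h, -⟩)
      · linarith
      · exact ENNReal.mul_ne_top ENNReal.ofReal_ne_top hfin.ne h
  have hE : 0 < S.toReal := ENNReal.toReal_pos hS0 hfin.ne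
  have hZr : 0 < Z.toReal := ENNReal.toReal_pos hZ hZt
  have hCyr : (0 : ℝ) < Cy := by
    have : Cy ≠ 0 := by simpa using hCy
    positivity
  have hSE : S = ENNReal.ofReal S.toReal := (ENNReal.ofReal_toReal hfin.ne).symm
  have hZE : Z = ENNReal.ofReal Z.toReal := (ENNReal.ofReal_toReal hZt).symm
  have hCyE : (Cy : ℝ≥0∞) = ENNReal.ofReal Cy := ENNReal.ofReal_coe_nnreal.symm
  have h2E : (2 : ℝ≥0∞) = ENNReal.ofReal 2 := by simp
  have hθr : θ * S.toReal < 2 * Z.toReal * Cy * (x / 2) ^ ρ := by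
    rw [hSE, hZE, hCyE, h2E, ENNReal.ofReal_rpow_of_pos (by positivity),
      ← ENNReal.ofReal_mul (by positivity), ← ENNReal.ofReal_mul (by positivity),
      ← ENNReal.ofReal_mul (by positivity), ← ENNReal.ofReal_mul (by positivity),
      ENNReal.ofReal_lt_ofReal_iff (by positivity)] at hθ
    exact hθ
  refine (_root_.measure_sup_gt_le hα hγ hρ0 hab hcd
    (fun p hp => (hU p hp).1.aestronglyMeasurable.aemeasurable) hcont
    (C := 2 * Z.toReal * Cy) (by positivity) hE (fun p hp => ?_) (hinc hZt) hθ0 hθ1 hθr hu).trans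
    (le_of_eq ?_)
  · rw [← subGaussianStandard_le_ofReal_iff hα0 hE.le, ← hSE]
    exact hS p hp
  · generalize S.toReal = E at hE hSE
    generalize Z.toReal = z at hZr hZE
    rw [hSE, hZE, hCyE, h2E, ← ENNReal.ofReal_mul (by positivity),
      ← ENNReal.ofReal_mul (by positivity), ← ENNReal.ofReal_mul (by positivity),
      ← ENNReal.ofReal_mul (by positivity), ← ENNReal.ofReal_mul (by positivity),
      ENNReal.ofReal_rpow_of_pos (by positivity), ENNReal.ofReal_rpow_of_pos (by positivity),
      ← ENNReal.ofReal_pow hx.le, ← ENNReal.ofReal_mul (by positivity),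
      ← ENNReal.ofReal_mul (by positivity), ← ENNReal.ofReal_mul (by positivity)]
    congr 5
    ring

end SolutionField

/-! ### Assembly of the two cases -/

theorem mainTheorem2 {Ω : Type*} [MeasurableSpace Ω] (P : Measure Ω) [IsProbabilityMeasure P]
    (N : ℕ) (hN : 1 ≤ N) (coef : ℕ → ℝ)
    (κ : ℝ → ℝ) (hκ : κ = Real.cos ∨ κ = Real.sin)
    (a b c d : ℝ) (hab : a ≤ b) (hcd : c ≤ d)
    (ρ : ℝ) (hρ0 : 0 < ρ) (hρ1 : ρ ≤ 1)
    (y : ℝ → Ω → ℝ)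
    (hvar : HasFiniteVitaliVariation (covFun y P))
    (hint : variationIntegral (covFun y P) (fun l m =>
        ENNReal.ofReal (|l| ^ ((2 * (N : ℝ) + 1) * (ρ + 1)) *
          |m| ^ ((2 * (N : ℝ) + 1) * (ρ + 1)))) < ∞) :
    -- the case of a strictly `φ`-sub-Gaussian process `y`, `φ(x) = |x| ^ α / α`
    (∀ α : ℝ, 1 < α → α ≤ 2 → ∀ Cy : ℝ≥0, IsStrictlyPhiSubGaussian (powerOrlicz α) y Cy P →
      -- (i) existence, continuity, Hölder continuity
      (∃ U : ℝ × ℝ → Ω → ℝ,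
        IsSolutionField κ N coef y (Icc a b ×ˢ Icc c d) U P ∧
        HasContinuousPathsOn (Icc a b ×ˢ Icc c d) U P) ∧
      (∀ U : ℝ × ℝ → Ω → ℝ,
        IsSolutionField κ N coef y (Icc a b ×ˢ Icc c d) U P →
        ∀ h : ℝ, 0 < h → ∀ t ∈ Icc a b, ∀ t₁ ∈ Icc a b, ∀ x ∈ Icc c d, ∀ x₁ ∈ Icc c d,
          |t - t₁| ≤ h → |x - x₁| ≤ h →
          subGaussianStandard (powerOrlicz α) (fun ω => U (t, x) ω - U (t₁, x₁) ω) P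
            ≤ 2 * constCZ (covFun y P) N coef ρ * Cy * ENNReal.ofReal (h ^ ρ)) ∧
      -- (the Hölder constant can be taken finite even if `C_Z = ∞`)
      (∃ K : ℝ≥0, ∀ U : ℝ × ℝ → Ω → ℝ,
        IsSolutionField κ N coef y (Icc a b ×ˢ Icc c d) U P →
        ∀ h : ℝ, 0 < h → ∀ t ∈ Icc a b, ∀ t₁ ∈ Icc a b, ∀ x ∈ Icc c d, ∀ x₁ ∈ Icc c d,
          |t - t₁| ≤ h → |x - x₁| ≤ h →
          subGaussianStandard (powerOrlicz α) (fun ω => U (t, x) ω - U (t₁, x₁) ω) P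
            ≤ (K : ℝ≥0∞) * ENNReal.ofReal (h ^ ρ)) ∧
      -- (ii) the distribution of the supremum
      (∀ U : ℝ × ℝ → Ω → ℝ,
        IsSolutionField κ N coef y (Icc a b ×ˢ Icc c d) U P →
        HasContinuousPathsOn (Icc a b ×ˢ Icc c d) U P →
        supStandard (powerOrlicz α) (Icc a b ×ˢ Icc c d) U P < ∞ ∧
        ∀ θ : ℝ, 0 < θ → θ < 1 →
          ENNReal.ofReal θ * supStandard (powerOrlicz α) (Icc a b ×ˢ Icc c d) U P
            < 2 * constCZ (covFun y P) N coef ρ * Cy *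
              ENNReal.ofReal (max (b - a) (d - c) / 2) ^ ρ →
          ∀ γ : ℝ, 1 / α + 1 / γ = 1 → ∀ u : ℝ, 0 < u →
            P {ω | ENNReal.ofReal u <
                ⨆ p ∈ Icc a b ×ˢ Icc c d, ENNReal.ofReal |U p ω|}
              ≤ 2 * ENNReal.ofReal (Real.exp (-(u ^ γ * (1 - θ) ^ γ /
                  (γ * (supStandard (powerOrlicz α) (Icc a b ×ˢ Icc c d) U P).toReal ^ γ)))) *
                (2 * ENNReal.ofReal (Real.exp 1) * constCZ (covFun y P) N coef ρ * Cy)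
                  ^ (2 / ρ) *
                ENNReal.ofReal (max (b - a) (d - c)) ^ 2 *
                (ENNReal.ofReal θ * supStandard (powerOrlicz α) (Icc a b ×ˢ Icc c d) U P)
                  ^ (-(2 / ρ)))) ∧
    -- the case of a centered Gaussian process `y`
    (IsGaussianProcess y P → (∀ s, ∫ ω, y s ω ∂P = 0) →
      (∃ U : ℝ × ℝ → Ω → ℝ,
        IsSolutionField κ N coef y (Icc a b ×ˢ Icc c d) U P ∧
        HasContinuousPathsOn (Icc a b ×ˢ Icc c d) U P) ∧
      (∀ U : ℝ × ℝ → Ω → ℝ,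
        IsSolutionField κ N coef y (Icc a b ×ˢ Icc c d) U P →
        HasContinuousPathsOn (Icc a b ×ˢ Icc c d) U P →
        supStandard (powerOrlicz 2) (Icc a b ×ˢ Icc c d) U P < ∞ ∧
        ∀ θ : ℝ, 0 < θ → θ < 1 →
          ENNReal.ofReal θ * supStandard (powerOrlicz 2) (Icc a b ×ˢ Icc c d) U P
            < 2 * constCZ (covFun y P) N coef ρ *
              ENNReal.ofReal (max (b - a) (d - c) / 2) ^ ρ →
          ∀ u : ℝ, 0 < u →
            P {ω | ENNReal.ofReal u <
                ⨆ p ∈ Icc a b ×ˢ Icc c d, ENNReal.ofReal |U p ω|}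
              ≤ 2 * ENNReal.ofReal (Real.exp (-(u ^ 2 * (1 - θ) ^ 2 /
                  (2 * (supStandard (powerOrlicz 2) (Icc a b ×ˢ Icc c d) U P).toReal ^ 2)))) *
                (2 * ENNReal.ofReal (Real.exp 1) * constCZ (covFun y P) N coef ρ) ^ (2 / ρ) *
                ENNReal.ofReal (max (b - a) (d - c)) ^ 2 *
                (ENNReal.ofReal θ * supStandard (powerOrlicz 2) (Icc a b ×ˢ Icc c d) U P)
                  ^ (-(2 / ρ)))) := by
  refine ⟨fun α hα1 _ Cy hs => ?_, fun hG h0 => ?_⟩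
  · have hα : 0 < α := by linarith
    have hy := hs.memLp
    refine ⟨exists_continuous_solutionField hκ hρ0 hρ1 hvar hint hα hs hy hab hcd,
      fun U hU h hh t ht t₁ ht₁ x hx x₁ hx₁ htt hxx =>
        hU.subGaussianStandard_sub_le hκ hρ0 hρ1 hvar hint hα hs hy (p := (t, x)) (q := (t₁, x₁))
          ⟨ht, hx⟩ ⟨ht₁, hx₁⟩ hh (max_le htt hxx), ?_,
      fun U hU hc => ⟨hU.supStandard_lt_top hκ hvar hα hs hy, fun θ hθ0 hθ1 hθ γ hγ u hu =>
        hU.measure_sup_gt_le hκ hρ0 hρ1 hvar hα1 hs hy hab hcd hc hθ0 hθ1 hθ hγ hu⟩⟩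
    obtain ⟨K, hK0, hK⟩ := exists_expMomentLE_sub (D := Icc a b ×ˢ Icc c d) (coef := coef) hκ hρ0
      hρ1 hvar hint hα hs hy
    refine ⟨Cy * K.toNNReal, fun U hU h hh t ht t₁ ht₁ x hx x₁ hx₁ htt hxx => ?_⟩
    have h1 := hK U hU (t, x) ⟨ht, hx⟩ (t₁, x₁) ⟨ht₁, hx₁⟩ h hh (max_le htt hxx)
    rw [← subGaussianStandard_le_ofReal_iff hα (by positivity)] at h1
    refine h1.trans (le_of_eq ?_)
    rw [← mul_assoc, ENNReal.ofReal_mul (by positivity), ENNReal.ofReal_mul (by positivity),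
      ENNReal.ofReal_coe_nnreal, ENNReal.coe_mul]
    rfl
  · have hs := hG.isStrictlyPhiSubGaussian h0
    have hy := hs.memLp
    refine ⟨exists_continuous_solutionField hκ hρ0 hρ1 hvar hint two_pos hs hy hab hcd,
      fun U hU hc => ⟨hU.supStandard_lt_top hκ hvar two_pos hs hy,
        fun θ hθ0 hθ1 hθ u hu => ?_⟩⟩
    have h1 := hU.measure_sup_gt_le hκ hρ0 hρ1 hvar one_lt_two hs hy hab hcd hc hθ0 hθ1
      (by rwa [ENNReal.coe_one, mul_one]) (γ := 2) (by norm_num) hu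
    simpa only [ENNReal.coe_one, mul_one, Real.rpow_two] using h1
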